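/- **Setting.** Let $d\ge 1$ and let $f:\mathbb R^d\to[0,\infty)$ be continuous, with $f(x)=0$ if and only if $x=0$, and $f(\lambda x)=\lambda f(x)$ for all $\lambda\ge 0$, $x\in\mathbb R^d$. Put $x\vee_f y:=x$ if $f(x)\ge f(y)$ and $x\vee_f y:=y$ if $f(x)<f(y)$, and $\bigvee^f_{1\le j\le k}x_j:=(\cdots(x_1\vee_f x_2)\vee_f\cdots)\vee_f x_k$. Let $\alpha>0$, let $\kappa$ be a Borel probability measure on $S:=\{f=1\}$, let $(E,\mathcal E,m)$ be a $\sigma$-finite measure space, $\mathcal E_0:=\{A\in\mathcal E: m(A)<\infty\}$, and let $(\Omega,\mathcal A,\mathbb P)$ be a probability space. Let $M$ assign to each $A\in\mathcal E_0$ an $\mathbb R^d$-valued random vector $M(A)$ on $\Omega$ such that: 1. for finitely many pairwise disjoint $A_1,\dots,A_k\in\mathcal E_0$ the vectors $M(A_1),\dots,M(A_k)$ are independent; 2. for pairwise disjoint $A_1,A_2,\dots\in\mathcal E_0$ with $\bigcup_j A_j\in\mathcal E_0$, almost surely there is a (random) index $j_0$ with $M(\bigcup_j A_j)=M(A_{j_0})=\bigvee^f_{1\le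 j\le n}M(A_j)$ for all $n\ge j_0$; 3. for every $A\in\mathcal E_0$, $M(A)\overset d= m(A)^{1/\alpha}Z\Theta$, where $Z$ and $\Theta$ are independent, $\Theta$ has law $\kappa$, and $\mathbb P(Z\le x)=e^{-x^{-\alpha}}$ for $x>0$, $\mathbb P(Z\le x)=0$ for $x\le 0$. A function $g:E\to[0,\infty)$ is *simple* if $g=\sum_{j=1}^k a_j\mathbf 1_{A_j}$ with $k\ge 1$, $a_j\ge 0$ and pairwise disjoint $A_j\in\mathcal E_0$; its integral is $I(g):=\bigvee^f_{1\le j\le k}a_jM(A_j)$, understood up to almost sure equality (it does a.s. not depend on the representation). Write $g_n\uparrow g$ if $g_n(s)\le g_{n+1}(s)$ and $g_n(s)\to g(s)$ for all $n$ and all $s\in E$. A measurable $g:E\to[0,\infty)$ is *$M$-integrable* if there are simple functions $g_n\uparrow g$ such that $I(g_n)$ converges in probability to an $\mathbb R^d$-valued random vector; $\mathcal I(M)$ is the set of all $M$-integrable functions. Let $L^\alpha_+(m)$ be the set of measurable $g:E\to[0,\infty)$ with $\left(\int_E g^\alpha\,dm\right)^{1/\alpha}<\infty$. **Theorem.** (a)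 $\mathcal I(M)=L^\alpha_+(m)$; in particular $\mathcal I(M)$ does not depend on $f$. (b) Let $g\in L^\alpha_+(m)$. For every sequence of simple functions $g_n\uparrow g$ the sequence $I(g_n)$ converges in probability, and the limit is a.s. the same for all such sequences. Hence the $f$-implicit extremal integral $I(g):=\mathbb P\text{-}\lim_{n\to\infty}I(g_n)$ is well defined up to almost sure equality. -/

import Mathlib

open MeasureTheory ProbabilityTheory Filter Topology
open scoped NNReal ENNReal

noncomputable section

namespace ImplicitExtremal

/-- `ℝᵈ` with the Euclidean norm. -/
abbrev Vec (d : ℕ) : Type := EuclideanSpace ℝ (Fin d)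

/-- Loss functions `f : ℝᵈ → [0, ∞)`: continuous, vanishing exactly at `0`, `1`-homogeneous. -/
structure IsLossFunction {d : ℕ} (f : Vec d → ℝ) : Prop where
  nonneg : ∀ x, 0 ≤ f x
  continuous : Continuous f
  eq_zero_iff : ∀ x, f x = 0 ↔ x = 0
  homogeneous : ∀ (c : ℝ) (x : Vec d), 0 ≤ c → f (c • x) = c * f x

/-- `x ∨_f y`: equals `x` if `f y ≤ f x`, and `y` if `f x < f y`. -/
def fJoin {d : ℕ} (f : Vec d → ℝ) (x y : Vec d) : Vec d :=
  if f y ≤ f x then x else y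

/-- `x 0 ∨_f x 1 ∨_f ⋯ ∨_f x n`, bracketed from the left. -/
def fMax {d : ℕ} (f : Vec d → ℝ) (x : ℕ → Vec d) : ℕ → Vec d
  | 0 => x 0
  | n + 1 => fJoin f (fMax f x n) (x (n + 1))

/-- `y` is the infinite `∨_f`-maximum of `x 0, x 1, …` and it is attained at some index:
`y = x j₀`, and the finite `∨_f`-maxima are equal to `y` from the index `j₀` on. -/
def IsAttainedFMax {d : ℕ} (f : Vec d → ℝ) (x : ℕ → Vec d) (y : Vec d) : Prop :=
  ∃ j₀ : ℕ, y = x j₀ ∧ ∀ n, j₀ ≤ n → fMax f x n = y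

/-- The set `S = {f = 1}`. -/
abbrev UnitLevel {d : ℕ} (f : Vec d → ℝ) : Type := {x : Vec d // f x = 1}

/-- `ζ` is the standard `α`-Fréchet distribution on `ℝ`, given by its distribution function. -/
structure IsStandardFrechet (α : ℝ) (ζ : Measure ℝ) : Prop where
  isProbabilityMeasure : IsProbabilityMeasure ζ
  apply_of_pos : ∀ x : ℝ, 0 < x → ζ (Set.Iic x) = ENNReal.ofReal (Real.exp (-x ^ (-α)))
  apply_of_nonpos : ∀ x : ℝ, x ≤ 0 → ζ (Set.Iic x) = 0

/-- `Y` has the `f`-implicit `α`-Fréchet distribution with scale `σ` and angular part `κ`: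
it is distributed like `σ Z Θ` with `Z` standard `α`-Fréchet, `Θ` of law `κ`,
and `Z`, `Θ` independent. -/
def HasImplicitFrechetLaw {d : ℕ} (f : Vec d → ℝ) (α : ℝ) (κ : Measure (UnitLevel f)) (σ : ℝ)
    {Ω : Type*} [MeasurableSpace Ω] (P : Measure Ω) (Y : Ω → Vec d) : Prop :=
  ∃ ζ : Measure ℝ, IsStandardFrechet α ζ ∧
    P.map Y = (ζ.prod κ).map (fun p : ℝ × UnitLevel f => (σ * p.1) • (p.2 : Vec d))

/-- The measurable sets of finite measure. -/
def finiteSets {E : Type*} [MeasurableSpace E] (m : Measure E) : Set (Set E) :=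
  {A | MeasurableSet A ∧ m A < ∞}

/-- `M` is an `f`-implicit sup-measure on the measurable sets of finite `m`-measure.
The values of `M` at other sets are irrelevant. -/
structure IsImplicitSupMeasure {d : ℕ} (f : Vec d → ℝ) {E : Type*} [MeasurableSpace E]
    (m : Measure E) {Ω : Type*} [MeasurableSpace Ω] (P : Measure Ω)
    (M : Set E → Ω → Vec d) : Prop where
  measurable : ∀ A ∈ finiteSets m, Measurable (M A)
  /-- independence over finitely many disjoint sets -/
  indep : ∀ (k : ℕ) (A : Fin k → Set E), (∀ j, A j ∈ finiteSets m) →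
    Pairwise (fun i j => Disjoint (A i) (A j)) → iIndepFun (fun j => M (A j)) P
  /-- `σ`-maximality, the maximum being attained at a random index -/
  iUnion : ∀ A : ℕ → Set E, (∀ j, A j ∈ finiteSets m) →
    Pairwise (fun i j => Disjoint (A i) (A j)) → (⋃ j, A j) ∈ finiteSets m →
    ∀ᵐ ω ∂P, IsAttainedFMax f (fun j => M (A j) ω) (M (⋃ j, A j) ω)

/-- `M` is an `f`-implicit `α`-Fréchet sup-measure with control measure `m` and angular part `κ`:
`M(A)` has the implicit Fréchet law with scale `m(A)^{1/α}`. -/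
structure IsFrechetSupMeasure {d : ℕ} (f : Vec d → ℝ) (α : ℝ) (κ : Measure (UnitLevel f))
    {E : Type*} [MeasurableSpace E] (m : Measure E) {Ω : Type*} [MeasurableSpace Ω]
    (P : Measure Ω) (M : Set E → Ω → Vec d) : Prop where
  isImplicitSupMeasure : IsImplicitSupMeasure f m P M
  law : ∀ A ∈ finiteSets m, HasImplicitFrechetLaw f α κ (m.real A ^ (1 / α)) P (M A)

/-- `g = ∑_{j=0}^{k} a_j 1_{A_j}` with `a_j ≥ 0` and disjoint `A_0, …, A_k` of finite measure.
Only the entries with index at most `k` matter. -/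
structure IsSimpleRep {E : Type*} [MeasurableSpace E] (m : Measure E) (g : E → ℝ≥0)
    (k : ℕ) (a : ℕ → ℝ≥0) (A : ℕ → Set E) : Prop where
  mem : ∀ j ≤ k, A j ∈ finiteSets m
  disjoint : ∀ i ≤ k, ∀ j ≤ k, i ≠ j → Disjoint (A i) (A j)
  eq_sum : ∀ s, g s = ∑ j ∈ Finset.range (k + 1), (A j).indicator (fun _ => a j) s

/-- Simple functions with respect to the sets of finite measure. -/
def IsSimple {E : Type*} [MeasurableSpace E] (m : Measure E) (g : E → ℝ≥0) : Prop :=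
  ∃ (k : ℕ) (a : ℕ → ℝ≥0) (A : ℕ → Set E), IsSimpleRep m g k a A

/-- `X` is (a version of) the integral `I(g)` of the simple function `g`:
a random vector which is a.s. equal to `a_0 M(A_0) ∨_f ⋯ ∨_f a_k M(A_k)` for some
representation of `g`. -/
def IsSimpleIntegral {d : ℕ} (f : Vec d → ℝ) {E : Type*} [MeasurableSpace E] (m : Measure E)
    {Ω : Type*} [MeasurableSpace Ω] (P : Measure Ω) (M : Set E → Ω → Vec d)
    (g : E → ℝ≥0) (X : Ω → Vec d) : Prop :=
  Measurable X ∧ ∃ (k : ℕ) (a : ℕ → ℝ≥0) (A : ℕ → Set E), IsSimpleRep m g k a A ∧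
    ∀ᵐ ω ∂P, X ω = fMax f (fun j => (a j : ℝ) • M (A j) ω) k

/-- `G n` are simple functions with `G n ↑ g` everywhere on `E`. -/
structure SimpleUp {E : Type*} [MeasurableSpace E] (m : Measure E) (G : ℕ → E → ℝ≥0)
    (g : E → ℝ≥0) : Prop where
  simple : ∀ n, IsSimple m (G n)
  mono : ∀ n s, G n s ≤ G (n + 1) s
  tendsto : ∀ s, Tendsto (fun n => G n s) atTop (𝓝 (g s))

/-- The random vector `Y` is a limit in probability of `I(g_n)` for some simple `g_n ↑ g`. -/
def IsIntegralLimit {d : ℕ} (f : Vec d → ℝ) {E : Type*} [MeasurableSpace E] (m : Measure E)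
    {Ω : Type*} [MeasurableSpace Ω] (P : Measure Ω) (M : Set E → Ω → Vec d)
    (g : E → ℝ≥0) (Y : Ω → Vec d) : Prop :=
  Measurable Y ∧ ∃ (G : ℕ → E → ℝ≥0) (X : ℕ → Ω → Vec d), SimpleUp m G g ∧
    (∀ n, IsSimpleIntegral f m P M (G n) (X n)) ∧ TendstoInMeasure P X atTop Y

/-- The set `𝓘(M)` of all `M`-integrable functions `g : E → [0, ∞)`. -/
def integrableFunctions {d : ℕ} (f : Vec d → ℝ) {E : Type*} [MeasurableSpace E] (m : Measure E)
    {Ω : Type*} [MeasurableSpace Ω] (P : Measure Ω) (M : Set E → Ω → Vec d) :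
    Set (E → ℝ≥0) :=
  {g | Measurable g ∧ ∃ Y, IsIntegralLimit f m P M g Y}

open Classical in
/-- The `f`-implicit extremal integral `I(g)`: a limit in probability of `I(g_n)` for some simple
`g_n ↑ g` (and `0` if there is none). -/
def extremalIntegral {d : ℕ} (f : Vec d → ℝ) {E : Type*} [MeasurableSpace E] (m : Measure E)
    {Ω : Type*} [MeasurableSpace Ω] (P : Measure Ω) (M : Set E → Ω → Vec d)
    (g : E → ℝ≥0) : Ω → Vec d :=
  if h : ∃ Y, IsIntegralLimit f m P M g Y then h.choose else 0

/-- `L^α_+(m)`: the measurable `g : E → [0, ∞)` with `(∫ g^α dm)^{1/α} < ∞`. -/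
def LPlus {E : Type*} [MeasurableSpace E] (α : ℝ) (m : Measure E) : Set (E → ℝ≥0) :=
  {g | Measurable g ∧ (∫⁻ s, (g s : ℝ≥0∞) ^ α ∂m) ^ (1 / α) < ∞}

end ImplicitExtremal

end

open ImplicitExtremal

/-! The losses `f (M A)` are Fréchet with mass `m A` and independent over disjoint sets, so for
simple `g` the loss of `I(g)` is Fréchet with mass `∫ g^α dm`. This controls sizes but not
directions: when the maximizing piece changes, the vector may jump even though its loss hardly
moves. Convergence therefore needs the maximizing piece to be stable.

Two simple functions `g`, `h` are written on a common finite partition `C i`, with values `x i`, `y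
i`. Fix `c > 1`. Three events are discarded: some piece whose values differ by more than the factor
`c` has `max (x i) (y i) * f (M (C i)) > r`; no piece dominates all others by the factor `c ^ 3` in
`x i * f (M (C i))`; some `x i * f (M (C i))` exceeds `K`. Otherwise both integrals are small, or
both come from the same piece with coefficients within the factor `c` (`norm_sub_le_of_dominating`).
The first and third events are handled by a union bound and the Fréchet tail. For the second,
`le_real_exists_dominating` gives at most `1 - c ^ (-3α)`, whatever the number of pieces; this
uniformity is the crux. The outcome is `real_le_norm_sub_le`.

If `g ∈ L^α_+(m)` and `G n`, `G' l` increase to `g`, dominated convergence makes the incomparable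
part negligible. Hence `I(G n) - I(G' l)` tends to `0` in probability as `n` and `l` grow
independently, which yields both existence and uniqueness of the limit. Conversely, if `∫ g^α dm =
∞`, the losses of `I(G n)` escape to infinity in probability, which no finite limit permits
(`mem_LPlus_of_isIntegralLimit`). -/

namespace ImplicitExtremal

/-! ### Fréchet and exponential variables -/

/-- `W` is a nonnegative random variable with `P(W ≤ x) = exp(-p x^{-α})` for `x > 0`. -/
structure IsFrechetOfMass {Ω : Type*} [MeasurableSpace Ω] (α : ℝ) (P : Measure Ω) (W : Ω → ℝ)
    (p : ℝ) : Prop where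
  measurable : Measurable W
  nonneg : ∀ ω, 0 ≤ W ω
  cdf_eq : ∀ x, 0 < x → P.real {ω | W ω ≤ x} = Real.exp (-(p * x ^ (-α)))

namespace IsFrechetOfMass

variable {Ω : Type*} [MeasurableSpace Ω] {α : ℝ} {P : Measure Ω} [IsProbabilityMeasure P]
  {W : Ω → ℝ} {p : ℝ}

theorem const_mul (h : IsFrechetOfMass α P W p) (hα : 0 < α) {a : ℝ} (ha : 0 ≤ a) :
    IsFrechetOfMass α P (fun ω => a * W ω) (a ^ α * p) where
  measurable := h.measurable.const_mul a
  nonneg ω := mul_nonneg ha (h.nonneg ω)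
  cdf_eq x hx := by
    rcases ha.eq_or_lt with rfl | ha
    · simp [Real.zero_rpow hα.ne', hx.le]
    · have : {ω | a * W ω ≤ x} = {ω | W ω ≤ x / a} := by
        ext ω; simp [le_div_iff₀' ha]
      rw [this, h.cdf_eq _ (by positivity), Real.div_rpow hx.le ha.le, Real.rpow_neg ha.le,
        div_inv_eq_mul]
      ring_nf

theorem tail_le (h : IsFrechetOfMass α P W p) {x : ℝ} (hx : 0 < x) :
    P.real {ω | x < W ω} ≤ p * x ^ (-α) := by
  have : {ω | x < W ω} = {ω | W ω ≤ x}ᶜ := by ext; simp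
  rw [this, probReal_compl_eq_one_sub (measurableSet_le h.measurable measurable_const),
    h.cdf_eq x hx]
  linarith [Real.add_one_le_exp (-(p * x ^ (-α)))]

theorem ae_pos (h : IsFrechetOfMass α P W p) (hα : 0 < α) (hp : 0 < p) : ∀ᵐ ω ∂P, 0 < W ω := by
  have hlim : Tendsto (fun x : ℝ => Real.exp (-(p * x ^ (-α)))) (𝓝[>] 0) (𝓝 0) := by
    refine Real.tendsto_exp_neg_atTop_nhds_zero.comp ?_
    exact (tendsto_rpow_neg_nhdsGT_zero (neg_lt_zero.2 hα)).const_mul_atTop hp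
  have hle : P.real {ω | W ω ≤ 0} ≤ 0 := by
    refine ge_of_tendsto hlim ?_
    filter_upwards [self_mem_nhdsWithin] with x hx
    rw [← h.cdf_eq x hx]
    exact measureReal_mono fun ω (hω : W ω ≤ 0) => hω.trans (le_of_lt hx)
  have h0 : P {ω | W ω ≤ 0} = 0 := by
    exact (measureReal_eq_zero_iff).1 (le_antisymm hle measureReal_nonneg)
  filter_upwards [measure_eq_zero_iff_ae_notMem.1 h0] with ω hω
  simpa using hω

end IsFrechetOfMass

theorem expMeasure_Ici {p x : ℝ} (hp : 0 < p) (hx : 0 ≤ x) :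
    (expMeasure p).real (Set.Ici x) = Real.exp (-(p * x)) := by
  have := isProbabilityMeasure_expMeasure hp
  have hna : NullSingletonClass (expMeasure p) :=
    inferInstanceAs (NullSingletonClass (volume.withDensity (gammaPDF 1 p)))
  have hc := cdf_expMeasure_eq hp x
  rw [cdf_eq_real, if_pos hx] at hc
  have h1 : (expMeasure p).real (Set.Iio x) = (expMeasure p).real (Set.Iic x) :=
    measureReal_congr Iio_ae_eq_Iic
  have h2 := probReal_compl_eq_one_sub (μ := expMeasure p) (measurableSet_Iio (a := x))
  rw [Set.compl_Iio] at h2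
  rw [h2, h1, hc]; ring

theorem expMeasure_ae_pos {p : ℝ} (hp : 0 < p) : ∀ᵐ t ∂(expMeasure p), 0 < t := by
  have := isProbabilityMeasure_expMeasure hp
  have hc := cdf_expMeasure_eq hp 0
  rw [cdf_eq_real] at hc
  simp only [le_refl, if_true, mul_zero, neg_zero, Real.exp_zero, sub_self] at hc
  have h0 : (expMeasure p) (Set.Iic 0) = 0 := (measureReal_eq_zero_iff).1 hc
  filter_upwards [measure_eq_zero_iff_ae_notMem.1 h0] with ω hω
  simpa using hω

/-- Tilting the exponential density of rate `p` by `exp (-(q * t))` gives `p / (p + q)` times the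
density of rate `p + q`. -/
theorem lintegral_exp_neg_expMeasure {p q : ℝ} (hp : 0 < p) (hq : 0 ≤ q) :
    ∫⁻ t, ENNReal.ofReal (Real.exp (-(q * t))) ∂(expMeasure p) = ENNReal.ofReal (p / (p + q)) := by
  have hpq : 0 < p + q := by linarith
  have hexp : expMeasure p = volume.withDensity (exponentialPDF p) := rfl
  have hmeas : ∀ r, Measurable (exponentialPDF r) := fun r =>
    (measurable_exponentialPDFReal r).ennreal_ofReal
  rw [hexp, lintegral_withDensity_eq_lintegral_mul _ (hmeas p) (by fun_prop)]
  calc _ = ∫⁻ t, ENNReal.ofReal (p / (p + q)) * exponentialPDF (p + q) t := by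
        refine lintegral_congr fun t => ?_
        simp only [Pi.mul_apply]
        rcases lt_or_ge t 0 with ht | ht
        · simp [exponentialPDF_of_neg ht]
        · rw [exponentialPDF_of_nonneg ht, exponentialPDF_of_nonneg ht,
            ← ENNReal.ofReal_mul (by positivity), ← ENNReal.ofReal_mul (by positivity)]
          congr 1
          rw [mul_assoc, ← Real.exp_add, ← mul_assoc, div_mul_cancel₀ _ hpq.ne']
          ring_nf
    _ = _ := by
        rw [lintegral_const_mul _ (hmeas _),
          lintegral_exponentialPDF_eq_one hpq, mul_one]

namespace IsFrechetOfMass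

variable {Ω : Type*} [MeasurableSpace Ω] {α : ℝ} {P : Measure Ω} [IsProbabilityMeasure P]
  {U V W : Ω → ℝ} {p q : ℝ}

/-- A Fréchet variable is a negative power of an exponential variable. -/
theorem map_eq (h : IsFrechetOfMass α P W p) (hα : 0 < α) (hp : 0 < p) :
    P.map W = (expMeasure p).map (fun t => t ^ (-(1 / α))) := by
  have := isProbabilityMeasure_expMeasure hp
  have hm : Measurable fun t : ℝ => t ^ (-(1 / α)) := by fun_prop
  have := Measure.isProbabilityMeasure_map (μ := P) h.measurable.aemeasurable
  have := Measure.isProbabilityMeasure_map (μ := expMeasure p) hm.aemeasurable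
  refine Measure.ext_of_Iic _ _ fun x => ?_
  rw [Measure.map_apply h.measurable measurableSet_Iic, Measure.map_apply hm measurableSet_Iic]
  rcases le_or_gt x 0 with hx | hx
  · rw [measure_eq_zero_iff_ae_notMem.2, measure_eq_zero_iff_ae_notMem.2]
    · filter_upwards [expMeasure_ae_pos hp] with t ht
      have : 0 < t ^ (-(1 / α)) := by positivity
      simpa using lt_of_le_of_lt hx this
    · filter_upwards [h.ae_pos hα hp] with ω hω
      simpa using lt_of_le_of_lt hx hω
  · rw [← measureReal_eq_measureReal_iff]
    have h1 : (expMeasure p).real ((fun t : ℝ => t ^ (-(1 / α))) ⁻¹' Set.Iic x)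
        = (expMeasure p).real (Set.Ici (x ^ (-α))) := by
      refine measureReal_congr ?_
      filter_upwards [expMeasure_ae_pos hp] with t ht
      refine propext ?_
      change t ^ (-(1 / α)) ≤ x ↔ x ^ (-α) ≤ t
      rw [← one_div_neg_eq_neg_one_div, one_div]
      exact Real.rpow_inv_le_iff_of_neg ht hx (neg_lt_zero.2 hα)
    rw [h1, expMeasure_Ici hp (by positivity)]
    exact h.cdf_eq x hx

/-- The probability that one of two independent Fréchet variables exceeds a multiple of the
other. -/
theorem real_mul_le (hU : IsFrechetOfMass α P U p) (hV : IsFrechetOfMass α P V q)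
    (hUV : IndepFun U V P) (hα : 0 < α) (hp : 0 < p) (hq : 0 ≤ q) {D : ℝ} (hD : 0 < D) :
    P.real {ω | D * V ω ≤ U ω} = p / (p + D ^ α * q) := by
  have hS : MeasurableSet {z : ℝ × ℝ | D * z.2 ≤ z.1} :=
    measurableSet_le (by fun_prop) (by fun_prop)
  have hm : Measurable fun t : ℝ => t ^ (-(1 / α)) := by fun_prop
  have hprob := Measure.isProbabilityMeasure_map (μ := P) hV.measurable.aemeasurable
  have key : P {ω | D * V ω ≤ U ω} = ENNReal.ofReal (p / (p + D ^ α * q)) := by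
    have h1 : P {ω | D * V ω ≤ U ω} = (P.map fun ω => (U ω, V ω)) {z | D * z.2 ≤ z.1} := by
      rw [Measure.map_apply (hU.measurable.prodMk hV.measurable) hS]; rfl
    -- Fubini, with `U = t ^ (-1/α)` for `t` exponential of rate `p`: the inner probability is `exp
    -- (-(D ^ α * q * t))`, a Laplace transform in `t`.
    rw [h1, hUV.map_prod_eq_prod_map_map hU.measurable.aemeasurable hV.measurable.aemeasurable,
      Measure.prod_apply hS, hU.map_eq hα hp,
      lintegral_map (measurable_measure_prodMk_left hS) hm,
      ← lintegral_exp_neg_expMeasure hp (by positivity)]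
    refine lintegral_congr_ae ?_
    filter_upwards [expMeasure_ae_pos hp] with t ht
    have ht' : 0 < t ^ (-(1 / α)) := by positivity
    rw [Measure.map_apply hV.measurable (measurable_prodMk_left hS)]
    have h2 : V ⁻¹' (Prod.mk (t ^ (-(1 / α))) ⁻¹' {z : ℝ × ℝ | D * z.2 ≤ z.1})
        = {ω | V ω ≤ t ^ (-(1 / α)) / D} := by
      ext ω; simp [le_div_iff₀' hD]
    rw [h2, ← ofReal_measureReal, hV.cdf_eq _ (by positivity)]
    congr 3
    rw [Real.div_rpow ht'.le hD.le, ← Real.rpow_mul ht.le, Real.rpow_neg hD.le, div_inv_eq_mul]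
    have : -(1 / α) * -α = 1 := by field_simp
    rw [this, Real.rpow_one]; ring
  rw [measureReal_def, key, ENNReal.toReal_ofReal (by positivity)]

end IsFrechetOfMass

theorem measurable_finset_sup_nnreal {Ω ι : Type*} [MeasurableSpace Ω] (s : Finset ι)
    {u : ι → Ω → ℝ≥0} (hu : ∀ i, Measurable (u i)) : Measurable fun ω => s.sup fun i => u i ω := by
  classical
  induction s using Finset.induction_on with
  | empty => simp
  | insert i s _ ih => simpa using (hu i).max ih

/-! ### Finite families of independent Fréchet variables -/

section Family

variable {Ω : Type*} [MeasurableSpace Ω] {α : ℝ} {P : Measure Ω} {ι : Type*} {U : ι → Ω → ℝ} {p : ι → ℝ}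

theorem real_forall_le (hind : iIndepFun U P) (hU : ∀ i, IsFrechetOfMass α P (U i) (p i))
    (s : Finset ι) {x : ℝ} (hx : 0 < x) :
    P.real {ω | ∀ i ∈ s, U i ω ≤ x} = Real.exp (-((∑ i ∈ s, p i) * x ^ (-α))) := by
  have h := iIndepFun_iff_measure_inter_preimage_eq_mul.1 hind s
    (sets := fun _ => Set.Iic x) fun _ _ => measurableSet_Iic
  have h1 : {ω | ∀ i ∈ s, U i ω ≤ x} = ⋂ i ∈ s, U i ⁻¹' Set.Iic x := by
    ext; simp
  rw [h1, measureReal_def, h, ENNReal.toReal_prod, Finset.sum_mul, ← Finset.sum_neg_distrib,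
    Real.exp_sum]
  exact Finset.prod_congr rfl fun i _ => (hU i).cdf_eq x hx

/-- Max-stability: the distribution functions multiply, so the masses add. The supremum is taken in
`ℝ≥0` so that the empty family has supremum `0`. -/
theorem isFrechetOfMass_sup (hind : iIndepFun U P) (hU : ∀ i, IsFrechetOfMass α P (U i) (p i))
    (s : Finset ι) :
    IsFrechetOfMass α P (fun ω => ((s.sup fun i => (U i ω).toNNReal : ℝ≥0) : ℝ))
      (∑ i ∈ s, p i) where
  measurable := by
    refine measurable_coe_nnreal_real.comp ?_
    exact measurable_finset_sup_nnreal _ fun i => (hU i).measurable.real_toNNReal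
  nonneg ω := NNReal.coe_nonneg _
  cdf_eq x hx := by
    rw [← real_forall_le hind hU s hx]
    congr 1
    ext ω
    lift x to ℝ≥0 using hx.le
    simp [Real.toNNReal_le_iff_le_coe]

theorem indepFun_sup (hind : iIndepFun U P) (hU : ∀ i, Measurable (U i)) {s : Finset ι} {k : ι}
    (hk : k ∉ s) :
    IndepFun (U k) (fun ω => ((s.sup fun i => (U i ω).toNNReal : ℝ≥0) : ℝ)) P := by
  have h := hind.indepFun_finset {k} s (by simpa using hk) hU
  have hφ : Measurable fun v : ({k} : Finset ι) → ℝ => v ⟨k, Finset.mem_singleton_self k⟩ :=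
    measurable_pi_apply _
  have hψ : Measurable fun v : s → ℝ => ((Finset.univ.sup fun i => (v i).toNNReal : ℝ≥0) : ℝ) :=
    measurable_coe_nnreal_real.comp
      (measurable_finset_sup_nnreal _ fun i => (measurable_pi_apply i).real_toNNReal)
  have hsup : (fun ω => ((s.sup fun i => (U i ω).toNNReal : ℝ≥0) : ℝ)) =
      (fun v : s → ℝ => ((Finset.univ.sup fun i => (v i).toNNReal : ℝ≥0) : ℝ)) ∘
        fun ω (i : s) => U i ω := by
    funext ω
    simp only [Function.comp_apply]
    rw [Finset.univ_eq_attach, Finset.sup_attach s fun i => (U i ω).toNNReal]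
  rw [hsup]
  exact h.comp hφ hψ

/-- With high probability the largest of finitely many independent Fréchet variables exceeds all
the others by a factor `D` close to `1`, uniformly in the number of variables. -/
theorem le_real_exists_dominating [IsProbabilityMeasure P] [Fintype ι] [DecidableEq ι] (hind : iIndepFun U P)
    (hU : ∀ i, IsFrechetOfMass α P (U i) (p i)) (hα : 0 < α) (hp : ∀ i, 0 ≤ p i)
    {D : ℝ} (hD : 1 < D) (hpos : 0 < ∑ i, p i) :
    D ^ (-α) ≤ P.real {ω | ∃ k, ∀ j ≠ k, D * U j ω ≤ U k ω} := by
  have hD0 : 0 < D := by linarith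
  -- Positivity of `U k` makes these events disjoint: two dominating indices would give `D ^ 2 * U k
  -- ≤ U k`.
  set A : ι → Set Ω := fun k => {ω | 0 < U k ω ∧ ∀ j ≠ k, D * U j ω ≤ U k ω} with hA
  have hAm : ∀ k, MeasurableSet (A k) := fun k => by
    have : A k = {ω | 0 < U k ω} ∩ ⋂ j, ⋂ (_ : j ≠ k), {ω | D * U j ω ≤ U k ω} := by
      ext; simp [hA]
    rw [this]
    refine (measurableSet_lt measurable_const (hU k).measurable).inter ?_
    exact MeasurableSet.iInter fun j => MeasurableSet.iInter fun _ =>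
      measurableSet_le ((hU j).measurable.const_mul D) (hU k).measurable
  have hdisj : Pairwise (Function.onFun Disjoint A) := by
    intro i j hij
    refine Set.disjoint_left.2 fun ω hi hj => ?_
    have h1 := hi.2 j hij.symm
    have h2 := hj.2 i hij
    nlinarith [hi.1, hj.1]
  have hAk : ∀ k, D ^ (-α) * (p k / ∑ i, p i) ≤ P.real (A k) := by
    intro k
    rcases (hp k).eq_or_lt with h0 | hpk
    · simp [← h0]
    have hsum : p k + ∑ i ∈ Finset.univ.erase k, p i = ∑ i, p i :=
      Finset.add_sum_erase _ _ (Finset.mem_univ k)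
    have hq : 0 ≤ ∑ i ∈ Finset.univ.erase k, p i := Finset.sum_nonneg fun i _ => hp i
    have heq := (hU k).real_mul_le (isFrechetOfMass_sup hind hU (Finset.univ.erase k))
      (indepFun_sup hind (fun i => (hU i).measurable) (by simp)) hα hpk hq hD0
    have hle : P.real {ω | D * (((Finset.univ.erase k).sup fun i => (U i ω).toNNReal : ℝ≥0) : ℝ)
        ≤ U k ω} ≤ P.real (A k) := by
      refine ENNReal.toReal_mono (measure_ne_top _ _) (measure_mono_ae ?_)
      filter_upwards [(hU k).ae_pos hα hpk] with ω hω h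
      refine ⟨hω, fun j hj => le_trans ?_ h⟩
      refine mul_le_mul_of_nonneg_left ?_ hD0.le
      have : (U j ω).toNNReal ≤ (Finset.univ.erase k).sup fun i => (U i ω).toNNReal :=
        Finset.le_sup (f := fun i => (U i ω).toNNReal) (by simp [hj])
      exact (Real.le_coe_toNNReal _).trans (by exact_mod_cast this)
    rw [heq] at hle
    refine le_trans ?_ hle
    -- With `q` the mass of the other variables, `p k + D ^ α * q ≤ D ^ α * (p k + q)`. The
    -- resulting lower bounds sum to `D ^ (-α)`.
    have hD1 : 1 ≤ D ^ α := Real.one_le_rpow hD.le hα.le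
    rw [Real.rpow_neg hD0.le, inv_mul_eq_div, div_div, ← hsum]
    refine div_le_div_of_nonneg_left hpk.le (by positivity) ?_
    nlinarith
  calc D ^ (-α) = ∑ k, D ^ (-α) * (p k / ∑ i, p i) := by
        rw [← Finset.mul_sum, ← Finset.sum_div, div_self hpos.ne', mul_one]
    _ ≤ ∑ k, P.real (A k) := Finset.sum_le_sum fun k _ => hAk k
    _ = P.real (⋃ k, A k) := by
        rw [measureReal_iUnion_fintype hdisj hAm]
    _ ≤ _ := measureReal_mono fun ω hω => by
        obtain ⟨k, hk⟩ := Set.mem_iUnion.1 hω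
        exact ⟨k, hk.2⟩

end Family

/-! ### Loss functions and finite `f`-maxima -/

section Deterministic

variable {d : ℕ} {f : Vec d → ℝ}

theorem IsLossFunction.map_zero (hf : IsLossFunction f) : f 0 = 0 := (hf.eq_zero_iff 0).2 rfl

/-- The loss is comparable to the norm from below. -/
theorem IsLossFunction.exists_norm_le (hf : IsLossFunction f) :
    ∃ c : ℝ, 0 < c ∧ ∀ x, ‖x‖ ≤ c * f x := by
  rcases (Metric.sphere (0 : Vec d) 1).eq_empty_or_nonempty with h | h
  -- The sphere is empty only in dimension `0`.
  · refine ⟨1, one_pos, fun x => ?_⟩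
    have : x = 0 := by
      by_contra hx
      have : (‖x‖⁻¹ • x) ∈ Metric.sphere (0 : Vec d) 1 := by
        simp [norm_smul, hx]
      simp [h] at this
    simp [this, hf.map_zero]
  · obtain ⟨u, hu, hmin⟩ := (isCompact_sphere (0 : Vec d) 1).exists_isMinOn h
      hf.continuous.continuousOn
    have hu0 : 0 < f u := by
      refine lt_of_le_of_ne (hf.nonneg u) fun h0 => ?_
      have := (hf.eq_zero_iff u).1 h0.symm
      simp [this] at hu
    refine ⟨(f u)⁻¹, by positivity, fun x => ?_⟩
    by_cases hx : x = 0
    · simp [hx, hf.map_zero]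
    have hx' : 0 < ‖x‖ := norm_pos_iff.2 hx
    have h1 : f u ≤ f (‖x‖⁻¹ • x) := hmin (by simp [norm_smul, hx])
    rw [hf.homogeneous _ _ (by positivity), inv_mul_eq_div, le_div_iff₀ hx'] at h1
    rw [inv_mul_eq_div, le_div_iff₀ hu0]
    linarith

/-- The loss is comparable to the norm from above. -/
theorem IsLossFunction.exists_le_norm (hf : IsLossFunction f) :
    ∃ c : ℝ, 0 ≤ c ∧ ∀ x, f x ≤ c * ‖x‖ := by
  obtain ⟨c, hc⟩ := (isCompact_sphere (0 : Vec d) 1).exists_bound_of_continuousOn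
    hf.continuous.continuousOn
  -- The bound `c` may be negative when the sphere is empty.
  refine ⟨max c 0, le_max_right _ _, fun x => ?_⟩
  by_cases hx : x = 0
  · simp [hx, hf.map_zero]
  have hx' : 0 < ‖x‖ := norm_pos_iff.2 hx
  have h1 := (le_abs_self _).trans (hc (‖x‖⁻¹ • x) (by simp [norm_smul, hx]))
  rw [hf.homogeneous _ _ (by positivity), inv_mul_eq_div, div_le_iff₀ hx'] at h1
  exact h1.trans (mul_le_mul_of_nonneg_right (le_max_left _ _) hx'.le)

/-- `y` is `0` or one of the `v j`, and has the largest loss among them. -/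
def IsFMaxOf (f : Vec d → ℝ) {ι : Type*} (v : ι → Vec d) (y : Vec d) : Prop :=
  (y = 0 ∨ ∃ j, y = v j) ∧ ∀ j, f (v j) ≤ f y

theorem le_fMax (f : Vec d → ℝ) (x : ℕ → Vec d) {j n : ℕ} (h : j ≤ n) :
    f (x j) ≤ f (fMax f x n) := by
  induction n with
  | zero => simp [Nat.le_zero.1 h, fMax]
  | succ n ih =>
    rw [fMax, fJoin]
    rcases h.eq_or_lt with rfl | h
    · split_ifs with h'
      · exact h'
      · exact le_rfl
    · have := ih (Nat.lt_succ_iff.1 h)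
      split_ifs with h'
      · exact this
      · exact this.trans (le_of_not_ge h')

theorem exists_fMax_eq (f : Vec d → ℝ) (x : ℕ → Vec d) (n : ℕ) : ∃ j ≤ n, fMax f x n = x j := by
  induction n with
  | zero => exact ⟨0, le_rfl, rfl⟩
  | succ n ih =>
    obtain ⟨j, hj, h⟩ := ih
    rw [fMax, fJoin]
    split_ifs
    · exact ⟨j, by omega, h⟩
    · exact ⟨n + 1, le_rfl, rfl⟩

theorem measurable_fMax {Ω : Type*} [MeasurableSpace Ω] (hf : IsLossFunction f)
    {x : ℕ → Ω → Vec d} {n : ℕ} (hx : ∀ j ≤ n, Measurable (x j)) :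
    Measurable fun ω => fMax f (fun j => x j ω) n := by
  induction n with
  | zero => exact hx 0 le_rfl
  | succ n ih =>
    have h1 := ih fun j hj => hx j (by omega)
    have h2 := hx (n + 1) le_rfl
    have hfm := hf.continuous.measurable
    exact Measurable.ite (measurableSet_le (hfm.comp h2) (hfm.comp h1)) h1 h2

end Deterministic

/-! ### Losses and maximality of the sup-measure -/

section SupMeasure

variable {d : ℕ} {f : Vec d → ℝ} {α : ℝ} {κ : Measure (UnitLevel f)} [IsProbabilityMeasure κ]
  {E : Type*} [MeasurableSpace E] {m : Measure E} {Ω : Type*} [MeasurableSpace Ω] {P : Measure Ω}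
  {M : Set E → Ω → Vec d}

/-- Since `f Θ = 1` and `Z > 0` almost surely, `f (σ Z Θ) = σ Z`: the angular part drops out, and `σ
^ α = m(A)`. Nothing else about the law of `M(A)` enters the proof. -/
theorem isFrechetOfMass_loss (hf : IsLossFunction f) (hα : 0 < α)
    (hM : IsFrechetSupMeasure f α κ m P M) {A : Set E} (hA : A ∈ finiteSets m) :
    IsFrechetOfMass α P (fun ω => f (M A ω)) (m.real A) where
  measurable := hf.continuous.measurable.comp (hM.isImplicitSupMeasure.measurable A hA)
  nonneg ω := hf.nonneg _
  cdf_eq x hx := by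
    obtain ⟨ζ, hζ, hlaw⟩ := hM.law A hA
    have := hζ.isProbabilityMeasure
    have hMA := hM.isImplicitSupMeasure.measurable A hA
    set σ : ℝ := m.real A ^ (1 / α) with hσ
    have hσ0 : 0 ≤ σ := by positivity
    have hS : MeasurableSet {y : Vec d | f y ≤ x} :=
      measurableSet_le hf.continuous.measurable measurable_const
    have hφ : Measurable fun p : ℝ × UnitLevel f => (σ * p.1) • (p.2 : Vec d) := by fun_prop
    have h0 : ∀ᵐ p ∂(ζ.prod κ), 0 < p.1 := by
      have h1 : ∀ᵐ z ∂ζ, 0 < z := by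
        filter_upwards [measure_eq_zero_iff_ae_notMem.1 (hζ.apply_of_nonpos 0 le_rfl)] with z hz
        simpa using hz
      exact Measure.quasiMeasurePreserving_fst.ae h1
    have h2 : P {ω | f (M A ω) ≤ x} = ζ {z | σ * z ≤ x} := by
      have h3 : P {ω | f (M A ω) ≤ x} = (P.map (M A)) {y | f y ≤ x} := by
        rw [Measure.map_apply hMA hS]; rfl
      rw [h3, hlaw, Measure.map_apply hφ hS]
      have h4 : (ζ.prod κ) ((fun p : ℝ × UnitLevel f => (σ * p.1) • (p.2 : Vec d)) ⁻¹'
          {y | f y ≤ x}) = (ζ.prod κ) ({z | σ * z ≤ x} ×ˢ Set.univ) := by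
        refine measure_congr ?_
        filter_upwards [h0] with p hp
        refine propext ?_
        change f ((σ * p.1) • (p.2 : Vec d)) ≤ x ↔ p ∈ {z | σ * z ≤ x} ×ˢ Set.univ
        rw [hf.homogeneous _ _ (by positivity), p.2.2, mul_one]
        simp
      rw [h4, Measure.prod_prod, measure_univ, mul_one]
    rw [measureReal_def, h2]
    rcases hσ0.eq_or_lt with h | h
    · have hm : m.real A = 0 := by
        by_contra hne
        have : 0 < m.real A := lt_of_le_of_ne measureReal_nonneg (Ne.symm hne)
        have : 0 < σ := by positivity
        linarith
      simp [← h, hx.le, hm]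
    · have h5 : {z | σ * z ≤ x} = Set.Iic (x / σ) := by
        ext z; simp [le_div_iff₀' h]
      rw [h5, hζ.apply_of_pos _ (by positivity), ENNReal.toReal_ofReal (by positivity),
        Real.div_rpow hx.le hσ0, Real.rpow_neg hσ0, div_inv_eq_mul, hσ,
        ← Real.rpow_mul measureReal_nonneg, one_div_mul_cancel hα.ne', Real.rpow_one, mul_comm]

theorem empty_mem_finiteSets (m : Measure E) : (∅ : Set E) ∈ finiteSets m := by
  simp [finiteSets]

theorem supMeasure_empty [IsProbabilityMeasure P] (hf : IsLossFunction f) (hα : 0 < α)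
    (hM : IsFrechetSupMeasure f α κ m P M) : ∀ᵐ ω ∂P, M ∅ ω = 0 := by
  have h := isFrechetOfMass_loss hf hα hM (empty_mem_finiteSets m)
  have h1 : ∀ n : ℕ, ∀ᵐ ω ∂P, f (M ∅ ω) ≤ 1 / ((n : ℝ) + 1) := fun n => by
    have hn : (0 : ℝ) < 1 / ((n : ℝ) + 1) := by positivity
    have h2 := h.tail_le hn
    simp only [measureReal_empty, zero_mul] at h2
    have h3 := (measureReal_eq_zero_iff).1 (le_antisymm h2 measureReal_nonneg)
    filter_upwards [measure_eq_zero_iff_ae_notMem.1 h3] with ω hω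
    simpa using hω
  filter_upwards [ae_all_iff.2 h1] with ω hω
  rw [← hf.eq_zero_iff]
  exact le_antisymm (ge_of_tendsto' tendsto_one_div_add_atTop_nhds_zero_nat hω) (hf.nonneg _)

/-- Enumerating the index set along `ℕ` leaves gaps, filled with `∅`, where `M` vanishes almost
surely; this is why `IsFMaxOf` admits the value `0`. It also forgets the order of the pieces, so
ties remain unresolved. -/
theorem isFMaxOf_iUnion [IsProbabilityMeasure P] (hf : IsLossFunction f) (hα : 0 < α)
    (hM : IsFrechetSupMeasure f α κ m P M) {ι : Type*} [Countable ι] {C : ι → Set E}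
    (hC : ∀ i, C i ∈ finiteSets m) (hdisj : Pairwise (Function.onFun Disjoint C))
    (hU : (⋃ i, C i) ∈ finiteSets m) :
    ∀ᵐ ω ∂P, IsFMaxOf f (fun i => M (C i) ω) (M (⋃ i, C i) ω) := by
  have := Encodable.ofCountable ι
  set D : ℕ → Set E := fun n => ⋃ b ∈ Encodable.decode₂ ι n, C b with hD
  have hDC : ∀ i, D (Encodable.encode i) = C i := fun i => by
    simp [hD]
  have hDe : ∀ n, D n = ∅ ∨ ∃ i, D n = C i := fun n => by
    rcases h : Encodable.decode₂ ι n with _ | i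
    · left; simp [hD, h]
    · right; exact ⟨i, by simp [hD, h]⟩
  have hDU : (⋃ n, D n) = ⋃ i, C i := Encodable.iUnion_decode₂ C
  have hDf : ∀ n, D n ∈ finiteSets m := fun n => by
    rcases hDe n with h | ⟨i, h⟩ <;> rw [h]
    · exact empty_mem_finiteSets m
    · exact hC i
  have hDd : Pairwise fun i j => Disjoint (D i) (D j) := Encodable.iUnion_decode₂_disjoint_on hdisj
  have h := hM.isImplicitSupMeasure.iUnion D hDf hDd (by rw [hDU]; exact hU)
  rw [hDU] at h
  filter_upwards [h, supMeasure_empty hf hα hM] with ω ⟨j₀, hj, hmax⟩ h0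
  refine ⟨?_, fun i => ?_⟩
  · rcases hDe j₀ with h' | ⟨i, h'⟩
    · left; rw [hj]; simp only [h', h0]
    · right; exact ⟨i, by rw [hj]; simp only [h']⟩
  -- At this index the finite maximum is final and already includes the piece `C i`.
  · have := le_fMax f (fun j => M (D j) ω) (le_max_right j₀ (Encodable.encode i))
    rw [hmax _ (le_max_left _ _)] at this
    simpa [hDC] using this

end SupMeasure

/-! ### Common refinement of representations -/

section Refinement

variable {E : Type*} [MeasurableSpace E] {m : Measure E}

/-- `g` is constant equal to `x i` on each `C i` and vanishes outside of their union. -/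
structure IsStepOn {E ι : Type*} (C : ι → Set E) (x : ι → ℝ≥0) (g : E → ℝ≥0) : Prop where
  eq_of_mem : ∀ i, ∀ s ∈ C i, g s = x i
  eq_zero : ∀ s, (∀ i, s ∉ C i) → g s = 0

theorem IsSimpleRep.apply_eq {g : E → ℝ≥0} {k : ℕ} {a : ℕ → ℝ≥0} {A : ℕ → Set E}
    (h : IsSimpleRep m g k a A) {j : ℕ} (hj : j ≤ k) {s : E} (hs : s ∈ A j) : g s = a j := by
  rw [h.eq_sum, Finset.sum_eq_single_of_mem j (by simp; omega)]
  · simp [hs]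
  · intro i hi hij
    have := h.disjoint i (by simp at hi; omega) j hj hij
    simp [Set.disjoint_right.1 this hs]

theorem IsSimpleRep.apply_eq_zero {g : E → ℝ≥0} {k : ℕ} {a : ℕ → ℝ≥0} {A : ℕ → Set E}
    (h : IsSimpleRep m g k a A) {s : E} (hs : ∀ j ≤ k, s ∉ A j) : g s = 0 := by
  rw [h.eq_sum]
  refine Finset.sum_eq_zero fun j hj => ?_
  simp [hs j (by simp at hj; omega)]

/-- The set of points lying in exactly those `B j` with `j ∈ T`. -/
def atom {E κ : Type*} (B : κ → Set E) (T : Finset κ) : Set E := {s | ∀ j, s ∈ B j ↔ j ∈ T}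

/-- The index set of the nonempty atoms inside the union of a finite family of sets. -/
abbrev AtomIndex {E κ : Type*} (B : κ → Set E) : Type _ :=
  {T : Finset κ // T.Nonempty ∧ (atom B T).Nonempty}

theorem pairwise_disjoint_atom {E κ : Type*} (B : κ → Set E) :
    Pairwise (Function.onFun Disjoint fun T : AtomIndex B => atom B T.1) := by
  intro S T hST
  refine Set.disjoint_left.2 fun s hS hT => hST (Subtype.ext (Finset.ext fun j => ?_))
  rw [← hS j, ← hT j]

theorem atom_mem_finiteSets {κ : Type*} [Finite κ] {B : κ → Set E}
    (hB : ∀ j, B j ∈ finiteSets m) (T : AtomIndex B) : atom B T.1 ∈ finiteSets m := by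
  obtain ⟨j, hj⟩ := T.2.1
  refine ⟨?_, (measure_mono fun s hs => (hs j).2 hj).trans_lt (hB j).2⟩
  have : atom B T.1 = ⋂ j, {s | s ∈ B j ↔ j ∈ T.1} := by ext; simp [atom]
  rw [this]
  refine MeasurableSet.iInter fun j => ?_
  by_cases h : j ∈ T.1
  · simpa [h] using (hB j).1
  · simp only [h, iff_false]
    exact (hB j).1.compl

theorem iUnion_atom {E κ : Type*} [Finite κ] (B : κ → Set E) (j : κ) :
    (⋃ T : {T : AtomIndex B // j ∈ T.1.1}, atom B T.1.1) = B j := by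
  classical
  have := Fintype.ofFinite κ
  ext s
  simp only [Set.mem_iUnion]
  constructor
  · rintro ⟨T, hT⟩
    exact (hT j).2 T.2
  · intro hs
    have hmem : s ∈ atom B (Finset.univ.filter fun j => s ∈ B j) := fun j => by simp
    refine ⟨⟨⟨_, ⟨j, ?_⟩, ⟨s, hmem⟩⟩, ?_⟩, hmem⟩ <;> simpa using hs

end Refinement

section Refinement

variable {d : ℕ} {f : Vec d → ℝ} {α : ℝ} {κ : Measure (UnitLevel f)} [IsProbabilityMeasure κ]
  {E : Type*} [MeasurableSpace E] {m : Measure E} {Ω : Type*} [MeasurableSpace Ω] {P : Measure Ω}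
  [IsProbabilityMeasure P] {M : Set E → Ω → Vec d}

/-- The integral of a simple function can be computed from any partition into atoms which
refines one of its representations. -/
theorem isFMaxOf_atom (hf : IsLossFunction f) (hα : 0 < α)
    (hM : IsFrechetSupMeasure f α κ m P M) {J : Type*} [Finite J] {B : J → Set E}
    (hB : ∀ j, B j ∈ finiteSets m) {g : E → ℝ≥0} {k : ℕ} {a : ℕ → ℝ≥0} {A : ℕ → Set E}
    (hrep : IsSimpleRep m g k a A) (hAB : ∀ j ≤ k, ∃ i, B i = A j) :
    ∃ x : AtomIndex B → ℝ≥0, IsStepOn (fun T : AtomIndex B => atom B T.1) x g ∧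
      ∀ᵐ ω ∂P, IsFMaxOf f (fun T => (x T : ℝ) • M (atom B T.1) ω)
        (fMax f (fun j => (a j : ℝ) • M (A j) ω) k) := by
  have : Nonempty J := ⟨(hAB 0 (Nat.zero_le k)).choose⟩
  choose! e he using hAB
  have hx : ∀ T : AtomIndex B, ∀ s ∈ atom B T.1, g s = g T.2.2.some := by
    intro T s hs
    have ht := T.2.2.some_mem
    set t := T.2.2.some
    by_cases h : ∃ j ≤ k, s ∈ A j
    · obtain ⟨j, hj, hsj⟩ := h
      have htj : t ∈ A j := by
        rw [← he j hj] at hsj ⊢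
        exact (ht _).2 ((hs _).1 hsj)
      rw [hrep.apply_eq hj hsj, hrep.apply_eq hj htj]
    · push Not at h
      rw [hrep.apply_eq_zero h, hrep.apply_eq_zero]
      intro j hj htj
      refine h j hj ?_
      rw [← he j hj] at htj ⊢
      exact (hs _).2 ((ht _).1 htj)
  -- An atom lies inside or outside each `A j`, so the value of `g` at one chosen point is its value
  -- on the whole atom.
  refine ⟨fun T => g T.2.2.some, ⟨hx, fun s hs => ?_⟩, ?_⟩
  · refine hrep.apply_eq_zero fun j hj hsj => ?_
    rw [← he j hj, ← iUnion_atom B (e j)] at hsj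
    obtain ⟨T, hT⟩ := Set.mem_iUnion.1 hsj
    exact hs T.1 hT
  · have hmax : ∀ i : J, ∀ᵐ ω ∂P, IsFMaxOf f
        (fun T : {T : AtomIndex B // i ∈ T.1.1} => M (atom B T.1.1) ω) (M (B i) ω) := fun i => by
      have h := isFMaxOf_iUnion hf hα hM
        (C := fun T : {T : AtomIndex B // i ∈ T.1.1} => atom B T.1.1)
        (fun T => atom_mem_finiteSets hB T.1)
        (fun S T hST => pairwise_disjoint_atom B (fun h => hST (Subtype.ext h)))
        (by rw [iUnion_atom]; exact hB i)
      rwa [iUnion_atom] at h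
    filter_upwards [ae_all_iff.2 hmax] with ω hω
    obtain ⟨⟨j, hj, hjeq⟩, hle⟩ : (∃ j ≤ k, _) ∧ _ :=
      ⟨exists_fMax_eq f (fun j => (a j : ℝ) • M (A j) ω) k,
        fun j (hj : j ≤ k) => le_fMax f (fun j => (a j : ℝ) • M (A j) ω) hj⟩
    have hval : ∀ (T : AtomIndex B), ∀ j ≤ k, e j ∈ T.1 → g T.2.2.some = a j := by
      intro T j hj hT
      refine hrep.apply_eq hj ?_
      rw [← he j hj]
      exact (T.2.2.some_mem _).2 hT
    refine ⟨?_, fun T => ?_⟩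
    · rw [hjeq]
      rcases (hω (e j)).1 with h0 | ⟨T, hT⟩
      · left; rw [← he j hj, h0, smul_zero]
      · right
        refine ⟨T.1, ?_⟩
        beta_reduce
        rw [hval T.1 j hj T.2, ← he j hj, hT]
    · beta_reduce
      by_cases h : ∃ j ≤ k, e j ∈ T.1
      · obtain ⟨j, hj, hT⟩ := h
        refine le_trans ?_ (hle j hj)
        rw [hval T j hj hT, hf.homogeneous _ _ (by positivity), hf.homogeneous _ _ (by positivity)]
        refine mul_le_mul_of_nonneg_left ?_ (by positivity)
        have := (hω (e j)).2 ⟨T, hT⟩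
        rwa [he j hj] at this
      · push Not at h
        have : g T.2.2.some = 0 := by
          refine hrep.apply_eq_zero fun j hj hs => h j hj ?_
          rw [← he j hj] at hs
          exact (T.2.2.some_mem _).1 hs
        rw [this, NNReal.coe_zero, zero_smul, hf.map_zero]
        exact hf.nonneg _

/-- The integrals of two simple functions can be computed from a common partition. -/
theorem exists_common_refinement (hf : IsLossFunction f) (hα : 0 < α)
    (hM : IsFrechetSupMeasure f α κ m P M) {g h : E → ℝ≥0} {X Y : Ω → Vec d}
    (hX : IsSimpleIntegral f m P M g X) (hY : IsSimpleIntegral f m P M h Y) :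
    ∃ (ι : Type) (_ : Finite ι) (C : ι → Set E) (x y : ι → ℝ≥0),
      (∀ i, C i ∈ finiteSets m) ∧ Pairwise (Function.onFun Disjoint C) ∧
      IsStepOn C x g ∧ IsStepOn C y h ∧
      (∀ᵐ ω ∂P, IsFMaxOf f (fun i => (x i : ℝ) • M (C i) ω) (X ω)) ∧
      ∀ᵐ ω ∂P, IsFMaxOf f (fun i => (y i : ℝ) • M (C i) ω) (Y ω) := by
  obtain ⟨-, k, a, A, hA, hXA⟩ := hX
  obtain ⟨-, l, b, B, hB, hYB⟩ := hY
  set S : Fin (k + 1) ⊕ Fin (l + 1) → Set E := Sum.elim (fun j => A j) (fun j => B j) with hS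
  have hSf : ∀ j, S j ∈ finiteSets m := by
    rintro (j | j)
    · exact hA.mem j (by omega)
    · exact hB.mem j (by omega)
  obtain ⟨x, hx, hxM⟩ := isFMaxOf_atom hf hα hM hSf hA
    fun j hj => ⟨Sum.inl ⟨j, by omega⟩, rfl⟩
  obtain ⟨y, hy, hyM⟩ := isFMaxOf_atom hf hα hM hSf hB
    fun j hj => ⟨Sum.inr ⟨j, by omega⟩, rfl⟩
  refine ⟨AtomIndex S, inferInstance, _, x, y, atom_mem_finiteSets hSf, pairwise_disjoint_atom S,
    hx, hy, ?_, ?_⟩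
  · filter_upwards [hXA, hxM] with ω h1 h2
    rwa [h1]
  · filter_upwards [hYB, hyM] with ω h1 h2
    rwa [h1]

end Refinement

/-! ### Cauchy sequences in probability -/

section ConvergenceInMeasure

variable {Ω F : Type*} [MeasurableSpace Ω] {P : Measure Ω} [IsProbabilityMeasure P]
  [NormedAddCommGroup F]

/-- `X n - X' N` tends to `0` in measure as both `n` and `N` tend to infinity. -/
def JointlyCauchyInMeasure (P : Measure Ω) (X X' : ℕ → Ω → F) : Prop :=
  ∀ ε > 0, ∀ η > 0, ∃ n₀ : ℕ, ∀ n ≥ n₀, ∀ N ≥ n₀, P.real {ω | ε ≤ ‖X n ω - X' N ω‖} ≤ η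

theorem JointlyCauchyInMeasure.tendstoInMeasure {X X' : ℕ → Ω → F} {Y : Ω → F}
    (h : JointlyCauchyInMeasure P X X') (hX : TendstoInMeasure P X atTop Y) :
    TendstoInMeasure P X' atTop Y := by
  rw [tendstoInMeasure_iff_measureReal_norm] at hX ⊢
  intro ε hε
  rw [Metric.tendsto_atTop]
  intro η hη
  obtain ⟨n₀, hn₀⟩ := h (ε / 2) (by positivity) (η / 3) (by positivity)
  obtain ⟨n₁, hn₁⟩ := Metric.tendsto_atTop.1 (hX (ε / 2) (by positivity)) (η / 3) (by positivity)
  refine ⟨n₀, fun N hN => ?_⟩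
  have h1 := hn₀ (max n₀ n₁) (le_max_left _ _) N hN
  have h2 := hn₁ (max n₀ n₁) (le_max_right _ _)
  rw [Real.dist_0_eq_abs, abs_of_nonneg measureReal_nonneg] at h2 ⊢
  set n := max n₀ n₁
  have h3 : P.real {ω | ε ≤ ‖X' N ω - Y ω‖} ≤
      P.real ({ω | ε / 2 ≤ ‖X n ω - X' N ω‖} ∪ {ω | ε / 2 ≤ ‖X n ω - Y ω‖}) := by
    refine measureReal_mono fun ω (hω : ε ≤ _) => ?_
    by_contra hc
    simp only [Set.mem_union, Set.mem_ofPred_eq, not_or, not_le] at hc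
    have := norm_sub_le_norm_sub_add_norm_sub (X' N ω) (X n ω) (Y ω)
    rw [norm_sub_rev (X' N ω) (X n ω)] at this
    linarith
  have h4 := measureReal_union_le (μ := P) {ω | ε / 2 ≤ ‖X n ω - X' N ω‖}
    {ω | ε / 2 ≤ ‖X n ω - Y ω‖}
  linarith

/-- Sequences which are Cauchy in measure converge in measure. -/
theorem JointlyCauchyInMeasure.exists_limit [CompleteSpace F] [MeasurableSpace F] [BorelSpace F]
    [SecondCountableTopology F] {X : ℕ → Ω → F} (hX : ∀ n, Measurable (X n))
    (h : JointlyCauchyInMeasure P X X) :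
    ∃ Y : Ω → F, Measurable Y ∧ TendstoInMeasure P X atTop Y := by
  -- Along `φ` the increments exceed `2 ^ (-k)` with probability at most `2 ^ (-k)`; Borel–Cantelli
  -- then gives almost sure convergence.
  obtain ⟨φ, hφ, hφP⟩ := extraction_forall_of_eventually
    (P := fun k n => ∀ a ≥ n, ∀ b ≥ n,
      P.real {ω | (1 / 2 : ℝ) ^ k ≤ ‖X a ω - X b ω‖} ≤ (1 / 2) ^ k)
    (fun k => by
      obtain ⟨n₀, hn₀⟩ := h ((1 / 2) ^ k) (by positivity) ((1 / 2) ^ k) (by positivity)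
      filter_upwards [eventually_ge_atTop n₀] with n hn a ha b hb
      exact hn₀ a (hn.trans ha) b (hn.trans hb))
  have hsum : ∑' k, P {ω | (1 / 2 : ℝ) ^ k ≤ ‖X (φ k) ω - X (φ (k + 1)) ω‖} ≠ ∞ := by
    refine ne_top_of_le_ne_top (summable_geometric_two.tsum_ofReal_ne_top)
      (ENNReal.tsum_le_tsum fun k => ?_)
    rw [← ofReal_measureReal]
    exact ENNReal.ofReal_le_ofReal (hφP k _ le_rfl _ (hφ.monotone k.le_succ))
  have hlim : ∀ᵐ ω ∂P, ∃ l, Tendsto (fun k => X (φ k) ω) atTop (𝓝 l) := by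
    filter_upwards [ae_eventually_notMem hsum] with ω hω
    refine cauchySeq_tendsto_of_complete (cauchySeq_of_summable_dist ?_)
    refine Summable.of_norm_bounded_eventually_nat summable_geometric_two ?_
    filter_upwards [hω] with k hk
    rw [dist_eq_norm, norm_norm]
    exact le_of_not_ge hk
  obtain ⟨Y, hY, hYlim⟩ := measurable_limit_of_tendsto_metrizable_ae
    (fun k => (hX (φ k)).aemeasurable) hlim
  have hsub : TendstoInMeasure P (fun k => X (φ k)) atTop Y :=
    tendstoInMeasure_of_tendsto_ae (fun k => (hX (φ k)).aestronglyMeasurable) hYlim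
  refine ⟨Y, hY, JointlyCauchyInMeasure.tendstoInMeasure (fun ε hε η hη => ?_) hsub⟩
  obtain ⟨n₀, hn₀⟩ := h ε hε η hη
  exact ⟨n₀, fun n hn N hN => hn₀ _ (hn.trans (hφ.id_le n)) N hN⟩

end ConvergenceInMeasure

/-! ### Integrals of step functions -/

section StepFunctions

variable {E : Type*} [MeasurableSpace E] {m : Measure E} {ι : Type*} {C : ι → Set E}
  {u v : ι → ℝ≥0} {g h : E → ℝ≥0}

theorem IsStepOn.map₂ {E ι : Type*} {C : ι → Set E} {u v : ι → ℝ≥0} {g h : E → ℝ≥0}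
    (hu : IsStepOn C u g) (hv : IsStepOn C v h)
    (F : ℝ≥0 → ℝ≥0 → ℝ≥0) (hF : F 0 0 = 0) :
    IsStepOn C (fun i => F (u i) (v i)) (fun s => F (g s) (h s)) where
  eq_of_mem i s hs := by rw [hu.eq_of_mem i s hs, hv.eq_of_mem i s hs]
  eq_zero s hs := by rw [hu.eq_zero s hs, hv.eq_zero s hs, hF]

theorem IsStepOn.lintegral_rpow [Fintype ι] {α : ℝ} (hα : 0 < α) (hu : IsStepOn C u g)
    (hC : ∀ i, MeasurableSet (C i)) (hdisj : Pairwise (Function.onFun Disjoint C)) :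
    ∫⁻ s, (g s : ℝ≥0∞) ^ α ∂m = ∑ i, (u i : ℝ≥0∞) ^ α * m (C i) := by
  classical
  have : ∀ s, (g s : ℝ≥0∞) ^ α = ∑ i, (C i).indicator (fun _ => (u i : ℝ≥0∞) ^ α) s := by
    intro s
    by_cases hs : ∃ i, s ∈ C i
    · obtain ⟨i, hi⟩ := hs
      rw [Finset.sum_eq_single_of_mem i (Finset.mem_univ i), hu.eq_of_mem i s hi,
        Set.indicator_of_mem hi]
      intro j _ hji
      exact Set.indicator_of_notMem (Set.disjoint_right.1 (hdisj hji) hi) _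
    · push Not at hs
      rw [hu.eq_zero s hs, ENNReal.coe_zero, ENNReal.zero_rpow_of_pos hα]
      exact (Finset.sum_eq_zero fun i _ => Set.indicator_of_notMem (hs i) _).symm
  simp_rw [this]
  rw [lintegral_finsetSum _ fun i _ => measurable_const.indicator (hC i)]
  exact Finset.sum_congr rfl fun i _ => lintegral_indicator_const (hC i) _

theorem IsStepOn.lintegral_rpow_lt_top [Fintype ι] {α : ℝ} (hα : 0 < α) (hu : IsStepOn C u g)
    (hC : ∀ i, C i ∈ finiteSets m) (hdisj : Pairwise (Function.onFun Disjoint C)) :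
    ∫⁻ s, (g s : ℝ≥0∞) ^ α ∂m < ∞ := by
  rw [hu.lintegral_rpow hα (fun i => (hC i).1) hdisj]
  exact ENNReal.sum_lt_top.2 fun i _ => ENNReal.mul_lt_top
    (ENNReal.rpow_lt_top_of_nonneg hα.le ENNReal.coe_ne_top) (hC i).2

theorem IsStepOn.toReal_lintegral_rpow [Fintype ι] {α : ℝ} (hα : 0 < α) (hu : IsStepOn C u g)
    (hC : ∀ i, C i ∈ finiteSets m) (hdisj : Pairwise (Function.onFun Disjoint C)) :
    (∫⁻ s, (g s : ℝ≥0∞) ^ α ∂m).toReal = ∑ i, (u i : ℝ) ^ α * m.real (C i) := by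
  rw [hu.lintegral_rpow hα (fun i => (hC i).1) hdisj, ENNReal.toReal_sum]
  · refine Finset.sum_congr rfl fun i _ => ?_
    rw [ENNReal.toReal_mul, ← ENNReal.toReal_rpow]
    rfl
  · exact fun i _ => (ENNReal.mul_lt_top
      (ENNReal.rpow_lt_top_of_nonneg hα.le ENNReal.coe_ne_top) (hC i).2).ne

theorem IsSimple.measurable (hg : IsSimple m g) : Measurable g := by
  obtain ⟨k, a, A, h⟩ := hg
  have : g = fun s => ∑ j ∈ Finset.range (k + 1), (A j).indicator (fun _ => a j) s :=
    funext h.eq_sum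
  rw [this]
  refine Finset.measurable_fun_sum _ fun j hj => measurable_const.indicator (h.mem j ?_).1
  simp at hj; omega

end StepFunctions

/-! ### Deterministic comparison of two maxima -/

section Comparison

variable {d : ℕ} {f : Vec d → ℝ}

/-- Two maxima with respect to comparable weights are close if the first one clearly dominates
and the incomparable entries are small. -/
theorem norm_sub_le_of_dominating (hf : IsLossFunction f) {N : ℝ} (hN0 : 0 < N)
    (hN : ∀ v, ‖v‖ ≤ N * f v) {ι : Type*}
    {w : ι → Vec d} {x y : ι → ℝ≥0} {X Y : Vec d}
    (hX : IsFMaxOf f (fun i => (x i : ℝ) • w i) X) (hY : IsFMaxOf f (fun i => (y i : ℝ) • w i) Y)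
    {c : ℝ≥0} (hc : 1 < c) {r K : ℝ} (hr : 0 ≤ r) (hK : 0 ≤ K)
    (hbad : ∀ i, (c * x i < y i ∨ c * y i < x i) → (max (x i) (y i) : ℝ≥0) * f (w i) ≤ r)
    (hdom : (∃ k, ∀ j ≠ k, (c : ℝ) ^ 3 * (x j * f (w j)) ≤ x k * f (w k)) ∨
      ∀ j, (x j : ℝ) * f (w j) = 0)
    (hXK : f X ≤ K) : ‖X - Y‖ ≤ N * ((c - 1) * K + 2 * (c * r)) := by
  have hc' : (1 : ℝ) < c := by exact_mod_cast hc
  have hhom : ∀ (a : ℝ≥0) (v : Vec d), f ((a : ℝ) • v) = a * f v := fun a v =>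
    hf.homogeneous _ _ a.2
  have hw := fun i => hf.nonneg (w i)
  simp only [IsFMaxOf, hhom] at hX hY
  obtain ⟨hX1, hX2⟩ := hX
  obtain ⟨hY1, hY2⟩ := hY
  have hgood : ∀ i, (max (x i) (y i) : ℝ≥0) * f (w i) ≤ r ∨
      ((y i : ℝ) ≤ c * x i ∧ (x i : ℝ) ≤ c * y i) := by
    intro i
    by_cases h : c * x i < y i ∨ c * y i < x i
    · exact Or.inl (hbad i h)
    · push Not at h
      exact Or.inr ⟨by exact_mod_cast h.1, by exact_mod_cast h.2⟩
  have hmaxx : ∀ i, (x i : ℝ) * f (w i) ≤ (max (x i) (y i) : ℝ≥0) * f (w i) := fun i =>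
    mul_le_mul_of_nonneg_right (by exact_mod_cast le_max_left (x i) (y i)) (hw i)
  have hmaxy : ∀ i, (y i : ℝ) * f (w i) ≤ (max (x i) (y i) : ℝ≥0) * f (w i) := fun i =>
    mul_le_mul_of_nonneg_right (by exact_mod_cast le_max_right (x i) (y i)) (hw i)
  have hXn := hf.nonneg X
  have hYn := hf.nonneg Y
  have hcr : r ≤ c * r := le_mul_of_one_le_left hr hc'.le
  have hsmall : f X ≤ c * r → f Y ≤ c * r → ‖X - Y‖ ≤ N * ((c - 1) * K + 2 * (c * r)) := by
    intro h1 h2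
    calc ‖X - Y‖ ≤ ‖X‖ + ‖Y‖ := norm_sub_le _ _
      _ ≤ N * (c * r) + N * (c * r) := add_le_add
          ((hN X).trans (mul_le_mul_of_nonneg_left h1 hN0.le))
          ((hN Y).trans (mul_le_mul_of_nonneg_left h2 hN0.le))
      _ ≤ N * ((c - 1) * K + 2 * (c * r)) := by
          have : 0 ≤ N * (((c : ℝ) - 1) * K) :=
            mul_nonneg hN0.le (mul_nonneg (by linarith) hK)
          linarith
  have hXr : f X ≤ r ∨ ∃ k, X = (x k : ℝ) • w k ∧ (y k : ℝ) ≤ c * x k ∧ (x k : ℝ) ≤ c * y k := by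
    rcases hX1 with h0 | ⟨k, hk⟩
    · left; rw [h0, hf.map_zero]; exact hr
    · rcases hgood k with h | h
      · left; rw [hk, hhom]; exact (hmaxx k).trans h
      · exact Or.inr ⟨k, hk, h⟩
  have hYr : f Y ≤ r ∨ ∃ k, Y = (y k : ℝ) • w k ∧ (y k : ℝ) ≤ c * x k ∧ (x k : ℝ) ≤ c * y k := by
    rcases hY1 with h0 | ⟨k, hk⟩
    · left; rw [h0, hf.map_zero]; exact hr
    · rcases hgood k with h | h
      · left; rw [hk, hhom]; exact (hmaxy k).trans h
      · exact Or.inr ⟨k, hk, h⟩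
  have hXY : ∀ k, X = (x k : ℝ) • w k → (x k : ℝ) ≤ c * y k → f X ≤ c * f Y := by
    intro k hk hxy
    rw [hk, hhom]
    have h1 := mul_le_mul_of_nonneg_right hxy (hw k)
    have h2 := mul_le_mul_of_nonneg_left (hY2 k) c.2
    simp only [NNReal.val_eq_coe] at h2
    linarith
  have hYX : ∀ k, Y = (y k : ℝ) • w k → (y k : ℝ) ≤ c * x k → f Y ≤ c * f X := by
    intro k hk hxy
    rw [hk, hhom]
    have h1 := mul_le_mul_of_nonneg_right hxy (hw k)
    have h2 := mul_le_mul_of_nonneg_left (hX2 k) c.2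
    simp only [NNReal.val_eq_coe] at h2
    linarith
  rcases le_or_gt (f X) r with hX0 | hX0
  · rcases hYr with h | ⟨j, hj, h1, h2⟩
    · exact hsmall (by linarith) (by linarith)
    · exact hsmall (by linarith) ((hYX j hj h1).trans (mul_le_mul_of_nonneg_left hX0 c.2))
  rcases le_or_gt (f Y) r with hY0 | hY0
  · rcases hXr with h | ⟨j, hj, h1, h2⟩
    · exact hsmall (by linarith) (by linarith)
    · exact hsmall ((hXY j hj h2).trans (mul_le_mul_of_nonneg_left hY0 c.2)) (by linarith)
  obtain ⟨k, hk, hk1, hk2⟩ := hXr.resolve_left (not_le.2 hX0)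
  obtain ⟨j, hj, hj1, hj2⟩ := hYr.resolve_left (not_le.2 hY0)
  have hXpos : 0 < f X := lt_of_le_of_lt hr hX0
  have hYpos : 0 < f Y := lt_of_le_of_lt hr hY0
  have hXk : f X = x k * f (w k) := by rw [hk, hhom]
  have hYj : f Y = y j * f (w j) := by rw [hj, hhom]
  rcases hdom with ⟨k', hk'⟩ | h0
  swap
  · linarith [h0 k]
  -- Otherwise the dominating entry would have loss at least `c ^ 3 * f X > f X`, against maximality
  -- of `X`.
  have hkk : k = k' := by
    by_contra hne
    have h1 := hk' k hne
    rw [← hXk] at h1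
    have h2 := hX2 k'
    have h3 : (1 : ℝ) < (c : ℝ) ^ 3 := one_lt_pow₀ hc' (by norm_num)
    nlinarith
  subst hkk
  -- Otherwise `c ^ 2 * f Y ≤ c ^ 3 * (x j * f (w j)) ≤ f X ≤ c * f Y`. Passing between `x` and `y`
  -- costs `c` twice; the third factor `c` gives the contradiction.
  have hjk : j = k := by
    by_contra hne
    have h1 := hk' j hne
    rw [← hXk] at h1
    have h2 := hXY k hk hk2
    have h3 : f Y ≤ c * (x j * f (w j)) := by
      rw [hYj, ← mul_assoc]
      exact mul_le_mul_of_nonneg_right hj1 (hw j)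
    have h4 : (c : ℝ) ^ 2 * f Y ≤ c * f Y := by
      have := mul_le_mul_of_nonneg_left h3 (sq_nonneg (c : ℝ))
      nlinarith
    have h5 : (c : ℝ) < c ^ 2 := by nlinarith
    nlinarith
  subst hjk
  have hdiff : |(x j : ℝ) - y j| ≤ (c - 1) * x j := by
    rw [abs_le]
    have hx0 : (0 : ℝ) ≤ x j := (x j).2
    have hy0 : (0 : ℝ) ≤ y j := (y j).2
    constructor
    · nlinarith
    · have : ((c : ℝ) - 1) * y j ≤ (c - 1) * x j ∨ (x j : ℝ) < y j := by
        rcases le_or_gt (y j : ℝ) (x j) with h | h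
        · exact Or.inl (mul_le_mul_of_nonneg_left h (by linarith))
        · exact Or.inr h
      rcases this with h | h <;> nlinarith
  calc ‖X - Y‖ = |(x j : ℝ) - y j| * ‖w j‖ := by
        rw [hk, hj, ← sub_smul, norm_smul, Real.norm_eq_abs]
    _ ≤ (c - 1) * x j * ‖w j‖ := mul_le_mul_of_nonneg_right hdiff (norm_nonneg _)
    _ = (c - 1) * ‖X‖ := by
        rw [hk, norm_smul, Real.norm_of_nonneg (x j).coe_nonneg]; ring
    _ ≤ (c - 1) * (N * K) := by
        refine mul_le_mul_of_nonneg_left ((hN X).trans ?_) (by linarith)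
        exact mul_le_mul_of_nonneg_left hXK hN0.le
    _ ≤ _ := by
        have : 0 ≤ N * (c * r) := mul_nonneg hN0.le (mul_nonneg c.2 hr)
        linarith

end Comparison

/-! ### Comparison of integrals of simple functions in probability -/

section Integral

variable {d : ℕ} {f : Vec d → ℝ} {α : ℝ} {κ : Measure (UnitLevel f)}
  {E : Type*} [MeasurableSpace E] {m : Measure E} {Ω : Type*} [MeasurableSpace Ω] {P : Measure Ω}
  {M : Set E → Ω → Vec d}

theorem iIndepFun_weighted (hf : IsLossFunction f)
    (hM : IsFrechetSupMeasure f α κ m P M) {ι : Type*} [Finite ι] {C : ι → Set E}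
    (hC : ∀ i, C i ∈ finiteSets m) (hdisj : Pairwise (Function.onFun Disjoint C)) (x : ι → ℝ≥0) :
    iIndepFun (fun i ω => (x i : ℝ) * f (M (C i) ω)) P := by
  obtain ⟨n, ⟨e⟩⟩ := Finite.exists_equiv_fin ι
  have h := hM.isImplicitSupMeasure.indep n (fun j => C (e.symm j)) (fun j => hC _)
    (fun i j hij => hdisj (e.symm.injective.ne hij))
  have h1 := h.precomp e.injective
  simp only [Equiv.symm_apply_apply] at h1
  exact h1.comp (fun i v => (x i : ℝ) * f v)
    fun i => (hf.continuous.measurable).const_mul _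

end Integral

section Integral

variable {d : ℕ} {f : Vec d → ℝ} {α : ℝ} {κ : Measure (UnitLevel f)} [IsProbabilityMeasure κ]
  {E : Type*} [MeasurableSpace E] {m : Measure E} {Ω : Type*} [MeasurableSpace Ω] {P : Measure Ω}
  [IsProbabilityMeasure P] {M : Set E → Ω → Vec d}

theorem isFrechetOfMass_weighted (hf : IsLossFunction f) (hα : 0 < α)
    (hM : IsFrechetSupMeasure f α κ m P M) {A : Set E} (hA : A ∈ finiteSets m) (a : ℝ≥0) :
    IsFrechetOfMass α P (fun ω => (a : ℝ) * f (M A ω)) ((a : ℝ) ^ α * m.real A) :=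
  (isFrechetOfMass_loss hf hα hM hA).const_mul hα a.2

/-- Quantitative comparison of the integrals of two simple functions. -/
theorem real_le_norm_sub_le (hf : IsLossFunction f) (hα : 0 < α)
    (hM : IsFrechetSupMeasure f α κ m P M) {N : ℝ} (hN0 : 0 < N)
    (hN : ∀ v, ‖v‖ ≤ N * f v) {g h : E → ℝ≥0} {X Y : Ω → Vec d}
    (hX : IsSimpleIntegral f m P M g X) (hY : IsSimpleIntegral f m P M h Y)
    {c : ℝ≥0} (hc : 1 < c) {r K ε : ℝ} (hr : 0 < r) (hK : 0 < K)
    (hε : N * ((c - 1) * K + 2 * (c * r)) < ε) :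
    P.real {ω | ε ≤ ‖X ω - Y ω‖} ≤
      (∫⁻ s, ((if c * g s < h s ∨ c * h s < g s then max (g s) (h s) else 0 : ℝ≥0) : ℝ≥0∞) ^ α
        ∂m).toReal * r ^ (-α) + (1 - ((c : ℝ) ^ 3) ^ (-α)) +
      (∫⁻ s, (g s : ℝ≥0∞) ^ α ∂m).toReal * K ^ (-α) := by
  classical
  obtain ⟨ι, _, C, x, y, hC, hdisj, hxg, hyh, hXm, hYm⟩ :=
    exists_common_refinement hf hα hM hX hY
  have := Fintype.ofFinite ι
  have hc' : (1 : ℝ) < c := by exact_mod_cast hc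
  have hc3 : (1 : ℝ) < (c : ℝ) ^ 3 := one_lt_pow₀ hc' (by norm_num)
  have hstep := hxg.map₂ hyh
    (fun a b => if c * a < b ∨ c * b < a then max a b else 0) (by simp)
  rw [hstep.toReal_lintegral_rpow hα hC hdisj, hxg.toReal_lintegral_rpow hα hC hdisj]
  set z : ι → ℝ≥0 := fun i =>
    if c * x i < y i ∨ c * y i < x i then max (x i) (y i) else 0 with hz
  have hunion : ∀ (u : ι → ℝ≥0) {t : ℝ}, 0 < t →
      P.real (⋃ i, {ω | t < u i * f (M (C i) ω)}) ≤
        (∑ i, (u i : ℝ) ^ α * m.real (C i)) * t ^ (-α) := by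
    intro u t ht
    refine (measureReal_iUnion_fintype_le _).trans ?_
    rw [Finset.sum_mul]
    exact Finset.sum_le_sum fun i _ => (isFrechetOfMass_weighted hf hα hM (hC i) (u i)).tail_le ht
  have hW := fun i => isFrechetOfMass_weighted hf hα hM (hC i) (x i)
  -- The second alternative covers total mass zero, where a positive dominating entry need not
  -- exist.
  set G : Set Ω := {ω | (∃ k, ∀ j ≠ k,
      (c : ℝ) ^ 3 * (x j * f (M (C j) ω)) ≤ x k * f (M (C k) ω)) ∨
      ∀ j, (x j : ℝ) * f (M (C j) ω) = 0} with hG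
  have hGm : MeasurableSet G := by
    have hmeas := fun i => (hW i).measurable
    have : G = (⋃ k, ⋂ j, ⋂ (_ : j ≠ k), {ω | (c : ℝ) ^ 3 * (x j * f (M (C j) ω)) ≤
        x k * f (M (C k) ω)}) ∪ ⋂ j, {ω | (x j : ℝ) * f (M (C j) ω) = 0} := by
      ext; simp [hG]
    rw [this]
    refine MeasurableSet.union ?_ ?_
    · exact MeasurableSet.iUnion fun k => MeasurableSet.iInter fun j => MeasurableSet.iInter
        fun _ => measurableSet_le ((hmeas j).const_mul _) (hmeas k)
    · exact MeasurableSet.iInter fun j => measurableSet_eq_fun (hmeas j) measurable_const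
  have hGP : ((c : ℝ) ^ 3) ^ (-α) ≤ P.real G := by
    have hp0 : ∀ i, 0 ≤ (x i : ℝ) ^ α * m.real (C i) := fun i => by positivity
    rcases (Finset.sum_nonneg fun i (_ : i ∈ Finset.univ) => hp0 i).eq_or_lt with h0 | hpos
    · have hall : ∀ᵐ ω ∂P, ω ∈ G := by
        have h1 : ∀ i, ∀ n : ℕ, ∀ᵐ ω ∂P, (x i : ℝ) * f (M (C i) ω) ≤ 1 / ((n : ℝ) + 1) := by
          intro i n
          have h2 := (hW i).tail_le (x := 1 / ((n : ℝ) + 1)) (by positivity)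
          rw [(Finset.sum_eq_zero_iff_of_nonneg fun i _ => hp0 i).1 h0.symm i (Finset.mem_univ i),
            zero_mul] at h2
          have h3 := (measureReal_eq_zero_iff).1 (le_antisymm h2 measureReal_nonneg)
          filter_upwards [measure_eq_zero_iff_ae_notMem.1 h3] with ω hω
          simpa using hω
        filter_upwards [ae_all_iff.2 fun i => ae_all_iff.2 (h1 i)] with ω hω
        exact Or.inr fun j => le_antisymm
          (ge_of_tendsto' tendsto_one_div_add_atTop_nhds_zero_nat (hω j)) ((hW j).nonneg ω)
      have : P.real G = 1 := by
        rw [measureReal_def, prob_compl_eq_zero_iff hGm |>.1 (mem_ae_iff.1 hall), ENNReal.toReal_one]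
      rw [this]
      exact Real.rpow_le_one_of_one_le_of_nonpos hc3.le (by linarith)
    · refine (le_real_exists_dominating (iIndepFun_weighted hf hM hC hdisj x) hW hα hp0 hc3
        hpos).trans (measureReal_mono fun ω hω => Or.inl hω)
  have hsub : P.real {ω | ε ≤ ‖X ω - Y ω‖} ≤
      P.real (((⋃ i, {ω | r < z i * f (M (C i) ω)}) ∪ Gᶜ) ∪
        ⋃ i, {ω | K < x i * f (M (C i) ω)}) := by
    refine ENNReal.toReal_mono (measure_ne_top _ _) (measure_mono_ae ?_)
    filter_upwards [hXm, hYm] with ω h1 h2 (h3 : ε ≤ _)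
    by_contra hcon
    replace hcon : ω ∉ ((⋃ i, {ω | r < z i * f (M (C i) ω)}) ∪ Gᶜ) ∪
        ⋃ i, {ω | K < x i * f (M (C i) ω)} := hcon
    simp only [Set.mem_union, Set.mem_iUnion, Set.mem_ofPred_eq, Set.mem_compl_iff, not_or,
      not_exists, not_lt, not_not] at hcon
    obtain ⟨⟨hb, hd⟩, hk⟩ := hcon
    have hXK : f (X ω) ≤ K := by
      rcases h1.1 with h0 | ⟨i, hi⟩
      · rw [h0, hf.map_zero]; exact hK.le
      · rw [hi]; beta_reduce; rw [hf.homogeneous _ _ (x i).coe_nonneg]; exact hk i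
    have := norm_sub_le_of_dominating hf hN0 hN h1 h2 hc hr.le hK.le (fun i hi => by
      have := hb i
      simpa only [hz, if_pos hi] using this) hd hXK
    linarith
  have h1 := measureReal_union_le (μ := P) ((⋃ i, {ω | r < z i * f (M (C i) ω)}) ∪ Gᶜ)
    (⋃ i, {ω | K < x i * f (M (C i) ω)})
  have h2 := measureReal_union_le (μ := P) (⋃ i, {ω | r < z i * f (M (C i) ω)}) Gᶜ
  have h3 := probReal_compl_eq_one_sub (μ := P) hGm
  have h4 := hunion z hr
  have h5 := hunion x hK
  linarith

/-- The distribution function of the loss of the integral of a simple function. -/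
theorem real_loss_le (hf : IsLossFunction f) (hα : 0 < α)
    (hM : IsFrechetSupMeasure f α κ m P M) {g : E → ℝ≥0} {X : Ω → Vec d}
    (hX : IsSimpleIntegral f m P M g X) {t : ℝ} (ht : 0 < t) :
    ∫⁻ s, (g s : ℝ≥0∞) ^ α ∂m < ∞ ∧ P.real {ω | f (X ω) ≤ t} ≤
      Real.exp (-((∫⁻ s, (g s : ℝ≥0∞) ^ α ∂m).toReal * t ^ (-α))) := by
  obtain ⟨ι, _, C, x, -, hC, hdisj, hxg, -, hXm, -⟩ := exists_common_refinement hf hα hM hX hX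
  have := Fintype.ofFinite ι
  refine ⟨hxg.lintegral_rpow_lt_top hα hC hdisj, ?_⟩
  rw [hxg.toReal_lintegral_rpow hα hC hdisj,
    ← real_forall_le (iIndepFun_weighted hf hM hC hdisj x)
      (fun i => isFrechetOfMass_weighted hf hα hM (hC i) (x i)) Finset.univ ht]
  -- If `f X ≤ t`, every weighted piece has loss at most `t`; only this inequality is needed.
  refine ENNReal.toReal_mono (measure_ne_top _ _) (measure_mono_ae ?_)
  filter_upwards [hXm] with ω h1 (h2 : f (X ω) ≤ t) i _
  have := h1.2 i
  beta_reduce at this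
  rw [hf.homogeneous _ _ (x i).coe_nonneg] at this
  exact this.trans h2

end Integral

/-! ### Approximation by simple functions -/

section Approximation

variable {E : Type*} [MeasurableSpace E] {m : Measure E}

theorem mem_LPlus_iff {α : ℝ} (hα : 0 < α) {g : E → ℝ≥0} :
    g ∈ LPlus α m ↔ Measurable g ∧ ∫⁻ s, (g s : ℝ≥0∞) ^ α ∂m < ∞ := by
  simp only [LPlus, Set.mem_ofPred_eq]
  rw [ENNReal.rpow_lt_top_iff_of_pos (by positivity)]

theorem IsStepOn.isSimple {ι : Type*} [Finite ι] {C : ι → Set E} {x : ι → ℝ≥0} {g : E → ℝ≥0}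
    (h : IsStepOn C x g) (hC : ∀ i, C i ∈ finiteSets m)
    (hdisj : Pairwise (Function.onFun Disjoint C)) : IsSimple m g := by
  classical
  obtain ⟨n, ⟨e⟩⟩ := Finite.exists_equiv_fin ι
  set A : ℕ → Set E := fun j => if hj : j < n then C (e.symm ⟨j, hj⟩) else ∅ with hA
  have hAe : ∀ i, A (e i) = C i := fun i => by simp [hA]
  have hmem : ∀ j s, s ∈ A j → ∃ i, s ∈ C i ∧ (e i : ℕ) = j := by
    intro j s hs
    by_cases hj : j < n
    · exact ⟨e.symm ⟨j, hj⟩, by simpa [hA, hj] using hs, by simp⟩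
    · simp [hA, hj] at hs
  -- A representation ending at index `n` has `n + 1` entries: the last one is empty with
  -- coefficient `0`, which also covers `n = 0`.
  refine ⟨n, fun j => if hj : j < n then x (e.symm ⟨j, hj⟩) else 0, A, ?_, ?_, ?_⟩
  · intro j _
    by_cases hj : j < n
    · simpa [hA, hj] using hC _
    · simp [hA, hj, finiteSets]
  · intro i _ j _ hij
    refine Set.disjoint_left.2 fun s hi hj => ?_
    obtain ⟨i', hi', rfl⟩ := hmem i s hi
    obtain ⟨j', hj', rfl⟩ := hmem j s hj
    have hne : i' ≠ j' := fun h => hij (by rw [h])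
    exact Set.disjoint_left.1 (hdisj hne) hi' hj'
  · intro s
    by_cases hs : ∃ i, s ∈ C i
    · obtain ⟨i, hi⟩ := hs
      rw [h.eq_of_mem i s hi, Finset.sum_eq_single_of_mem (e i : ℕ)
        (Finset.mem_range.2 (by omega))]
      · rw [hAe, Set.indicator_of_mem hi]; simp
      · intro j _ hj
        refine Set.indicator_of_notMem (fun hsj => ?_) _
        obtain ⟨i', hi', rfl⟩ := hmem j s hsj
        have hne : i' ≠ i := fun h => hj (by rw [h])
        exact Set.disjoint_left.1 (hdisj hne) hi' hi
    · push Not at hs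
      rw [h.eq_zero s hs]
      refine (Finset.sum_eq_zero fun j _ => Set.indicator_of_notMem (fun hsj => ?_) _).symm
      obtain ⟨i, hi, -⟩ := hmem j s hsj
      exact hs i hi

theorem isSimple_indicator (φ : SimpleFunc E ℝ≥0) {S : Set E} (hS : S ∈ finiteSets m) :
    IsSimple m (S.indicator φ) := by
  refine IsStepOn.isSimple (ι := φ.range) (C := fun c => φ ⁻¹' {c.1} ∩ S) (x := fun c => c.1)
    ⟨?_, ?_⟩ ?_ ?_
  · rintro c s ⟨hs, hsS⟩
    rw [Set.indicator_of_mem hsS]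
    exact hs
  · intro s hs
    exact Set.indicator_of_notMem
      (fun hsS => hs ⟨φ s, φ.mem_range_self s⟩ ⟨rfl, hsS⟩) _
  · exact fun c => ⟨(φ.measurableSet_fiber _).inter hS.1,
      (measure_mono Set.inter_subset_right).trans_lt hS.2⟩
  · intro c c' hcc
    refine Set.disjoint_left.2 fun s hs hs' => hcc (Subtype.ext ?_)
    exact hs.1.symm.trans hs'.1

theorem exists_simpleUp [SigmaFinite m] {g : E → ℝ≥0} (hg : Measurable g) :
    ∃ G : ℕ → E → ℝ≥0, SimpleUp m G g := by
  set γ : E → ℝ≥0∞ := fun s => g s with hγ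
  have hγm : Measurable γ := hg.coe_nnreal_ennreal
  refine ⟨fun n => (spanningSets m n).indicator
    ((SimpleFunc.eapprox γ n).map ENNReal.toNNReal), fun n => ?_, fun n s => ?_, fun s => ?_⟩
  · exact isSimple_indicator _ ⟨measurableSet_spanningSets m n, measure_spanningSets_lt_top m n⟩
  · refine (Set.indicator_le_indicator_of_subset (monotone_spanningSets m n.le_succ)
      (fun _ => zero_le) s).trans (Set.indicator_le_indicator ?_)
    exact ENNReal.toNNReal_mono (SimpleFunc.eapprox_lt_top γ _ s).ne
      (SimpleFunc.monotone_eapprox γ n.le_succ s)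
  · have h1 : Tendsto (fun n => (SimpleFunc.eapprox γ n s).toNNReal) atTop (𝓝 (g s)) := by
      have := (ENNReal.tendsto_toNNReal (a := γ s) ENNReal.coe_ne_top).comp
        (SimpleFunc.tendsto_eapprox hγm s)
      exact this
    refine h1.congr' ?_
    filter_upwards [eventually_mem_spanningSets m s] with n hn
    rw [Set.indicator_of_mem hn]
    rfl

theorem SimpleUp.le {G : ℕ → E → ℝ≥0} {g : E → ℝ≥0} (h : SimpleUp m G g) (n : ℕ) (s : E) :
    G n s ≤ g s :=
  (monotone_nat_of_le_succ fun n => h.mono n s).ge_of_tendsto (h.tendsto s) n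

/-- Where `g s > 0`, `c * G n s` tends to `c * g s > g s`, so `s` eventually leaves the set; `g ^ α`
dominates. -/
theorem SimpleUp.tendsto_lintegral_incomparable {α : ℝ} (hα : 0 < α) {G : ℕ → E → ℝ≥0}
    {g : E → ℝ≥0} (h : SimpleUp m G g) (hg : g ∈ LPlus α m) {c : ℝ≥0} (hc : 1 < c) :
    Tendsto (fun n => ∫⁻ s in {s | c * G n s < g s}, (g s : ℝ≥0∞) ^ α ∂m) atTop (𝓝 0) := by
  obtain ⟨hgm, hgi⟩ := (mem_LPlus_iff hα).1 hg
  have hms : ∀ n, MeasurableSet {s | c * G n s < g s} := fun n =>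
    measurableSet_lt ((h.simple n).measurable.const_mul c) hgm
  have hgα : Measurable fun s => (g s : ℝ≥0∞) ^ α := hgm.coe_nnreal_ennreal.pow_const α
  have h1 := tendsto_lintegral_of_dominated_convergence (μ := m)
    (F := fun n => {s | c * G n s < g s}.indicator fun s => (g s : ℝ≥0∞) ^ α)
    (f := fun _ => 0) (fun s => (g s : ℝ≥0∞) ^ α) (fun n => hgα.indicator (hms n))
    (fun n => ae_of_all _ fun s => Set.indicator_le_self _ _ s) hgi.ne
    (ae_of_all _ fun s => by
      refine tendsto_const_nhds.congr' ?_
      rcases eq_or_ne (g s) 0 with h0 | h0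
      · exact Eventually.of_forall fun n => by simp [h0]
      · have hlt : g s < c * g s := lt_mul_of_one_lt_left (pos_iff_ne_zero.2 h0) hc
        filter_upwards [((h.tendsto s).const_mul c).eventually_const_lt hlt] with n hn
        rw [Set.indicator_of_notMem]
        exact not_lt.2 hn.le)
  simp only [lintegral_zero] at h1
  refine h1.congr fun n => ?_
  rw [lintegral_indicator (hms n)]

end Approximation

/-! ### Convergence for `L^α_+` and its converse -/

section Integral

variable {d : ℕ} {f : Vec d → ℝ} {α : ℝ} {κ : Measure (UnitLevel f)} [IsProbabilityMeasure κ]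
  {E : Type*} [MeasurableSpace E] {m : Measure E} {Ω : Type*} [MeasurableSpace Ω] {P : Measure Ω}
  [IsProbabilityMeasure P] {M : Set E → Ω → Vec d}

theorem exists_isSimpleIntegral {d : ℕ} {f : Vec d → ℝ} {E : Type*} [MeasurableSpace E]
    {m : Measure E} {Ω : Type*} [MeasurableSpace Ω] {P : Measure Ω} {M : Set E → Ω → Vec d}
    (hf : IsLossFunction f) (hM : IsImplicitSupMeasure f m P M) {g : E → ℝ≥0}
    (hg : IsSimple m g) : ∃ X, IsSimpleIntegral f m P M g X := by
  obtain ⟨k, a, A, h⟩ := hg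
  refine ⟨fun ω => fMax f (fun j => (a j : ℝ) • M (A j) ω) k, ?_, k, a, A, h,
    ae_of_all _ fun _ => rfl⟩
  exact measurable_fMax (x := fun j ω => (a j : ℝ) • M (A j) ω) hf
    fun j hj => (hM.measurable _ (h.mem j hj)).const_smul (a j : ℝ)

/-- Equal sequences give the Cauchy property; different ones give independence of the limit from the
sequence. -/
theorem jointlyCauchyInMeasure_integral (hf : IsLossFunction f) (hα : 0 < α)
    (hM : IsFrechetSupMeasure f α κ m P M) {g : E → ℝ≥0} (hg : g ∈ LPlus α m)
    {G G' : ℕ → E → ℝ≥0} (hG : SimpleUp m G g) (hG' : SimpleUp m G' g) {X X' : ℕ → Ω → Vec d}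
    (hX : ∀ n, IsSimpleIntegral f m P M (G n) (X n))
    (hX' : ∀ n, IsSimpleIntegral f m P M (G' n) (X' n)) : JointlyCauchyInMeasure P X X' := by
  intro ε hε η hη
  obtain ⟨N, hN0, hN⟩ := hf.exists_norm_le
  obtain ⟨hgm, hgi⟩ := (mem_LPlus_iff hα).1 hg
  set I := (∫⁻ s, (g s : ℝ≥0∞) ^ α ∂m).toReal with hI
  -- Each of the three error terms gets `η / 3`. The order is essential: `c` depends on `K`, then
  -- `r` on `c`, and `δ` on `r`.
  obtain ⟨K, hKη, hK⟩ : ∃ K : ℝ, I * K ^ (-α) < η / 3 ∧ 0 < K := by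
    have h1 : Tendsto (fun K : ℝ => I * K ^ (-α)) atTop (𝓝 (I * 0)) :=
      (tendsto_rpow_neg_atTop hα).const_mul I
    rw [mul_zero] at h1
    exact ((h1.eventually_lt_const (by positivity)).and (eventually_gt_atTop 0)).exists
  obtain ⟨c, ⟨hc1, hc2⟩, hc⟩ : ∃ c : ℝ≥0, (1 - ((c : ℝ) ^ 3) ^ (-α) < η / 3 ∧
      N * ((c - 1) * K) < ε / 2) ∧ 1 < c := by
    have hcoe : Tendsto (fun c : ℝ≥0 => (c : ℝ)) (𝓝[>] 1) (𝓝 1) := by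
      have : Tendsto (fun c : ℝ≥0 => (c : ℝ)) (𝓝 1) (𝓝 ((1 : ℝ≥0) : ℝ)) :=
        NNReal.continuous_coe.tendsto 1
      exact this.mono_left nhdsWithin_le_nhds
    have h1 : Tendsto (fun c : ℝ≥0 => 1 - ((c : ℝ) ^ 3) ^ (-α)) (𝓝[>] 1)
        (𝓝 (1 - ((1 : ℝ) ^ 3) ^ (-α))) :=
      tendsto_const_nhds.sub ((hcoe.pow 3).rpow_const (Or.inl (by norm_num)))
    have h2 : Tendsto (fun c : ℝ≥0 => N * (((c : ℝ) - 1) * K)) (𝓝[>] 1)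
        (𝓝 (N * ((1 - 1) * K))) :=
      ((hcoe.sub tendsto_const_nhds).mul_const K).const_mul N
    simp only [one_pow, Real.one_rpow, sub_self, zero_mul, mul_zero] at h1 h2
    exact (((h1.eventually_lt_const (by positivity)).and
      (h2.eventually_lt_const (by positivity))).and self_mem_nhdsWithin).exists
  have hc0 : (0 : ℝ) < c := by exact_mod_cast one_pos.trans hc
  set r : ℝ := ε / (8 * N * c) with hr
  have hr0 : 0 < r := by positivity
  have hεr : N * ((c - 1) * K + 2 * (c * r)) < ε := by
    have : N * (2 * (c * r)) = ε / 4 := by rw [hr]; field_simp; ring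
    linarith
  set δ : ℝ := η / 6 * r ^ α with hδ
  have hδ0 : 0 < δ := by positivity
  have hev : ∀ {H : ℕ → E → ℝ≥0}, SimpleUp m H g → ∃ n₀, ∀ n ≥ n₀,
      ∫⁻ s in {s | c * H n s < g s}, (g s : ℝ≥0∞) ^ α ∂m < ENNReal.ofReal δ := fun hH =>
    eventually_atTop.1 ((hH.tendsto_lintegral_incomparable hα hg hc).eventually_lt_const
      (ENNReal.ofReal_pos.2 hδ0))
  obtain ⟨n₁, hn₁⟩ := hev hG
  obtain ⟨n₂, hn₂⟩ := hev hG'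
  refine ⟨max n₁ n₂, fun n hn l hl => ?_⟩
  have hmain := real_le_norm_sub_le hf hα hM hN0 hN (hX n) (hX' l) hc hr0 hK hεr
  have hA := hn₁ n ((le_max_left _ _).trans hn)
  have hB := hn₂ l ((le_max_right _ _).trans hl)
  have hms : ∀ {H : ℕ → E → ℝ≥0}, SimpleUp m H g → ∀ n, MeasurableSet {s | c * H n s < g s} :=
    fun hH n => measurableSet_lt ((hH.simple n).measurable.const_mul c) hgm
  -- Since both functions lie below `g`, `c * G n s < G' l s` forces `c * G n s < g s`, and
  -- symmetrically.
  have hbad : ∫⁻ s, ((if c * G n s < G' l s ∨ c * G' l s < G n s then max (G n s) (G' l s)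
      else 0 : ℝ≥0) : ℝ≥0∞) ^ α ∂m ≤ ENNReal.ofReal δ + ENNReal.ofReal δ := by
    refine le_trans ?_ (add_le_add hA.le hB.le)
    rw [← lintegral_indicator (hms hG n), ← lintegral_indicator (hms hG' l),
      ← lintegral_add_left ((hgm.coe_nnreal_ennreal.pow_const α).indicator (hms hG n))]
    refine lintegral_mono fun s => ?_
    have hle : ((max (G n s) (G' l s) : ℝ≥0) : ℝ≥0∞) ^ α ≤ (g s : ℝ≥0∞) ^ α := by
      refine ENNReal.rpow_le_rpow ?_ hα.le
      exact_mod_cast max_le (hG.le n s) (hG'.le l s)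
    beta_reduce
    split_ifs with hs
    · refine hle.trans ?_
      rcases hs with hs | hs
      · rw [Set.indicator_of_mem (s := {s | c * G n s < g s}) (hs.trans_le (hG'.le l s))]
        exact le_self_add
      · rw [Set.indicator_of_mem (s := {s | c * G' l s < g s}) (hs.trans_le (hG.le n s))]
        exact le_add_self
    · simp [ENNReal.zero_rpow_of_pos hα]
  have hbad' := ENNReal.toReal_mono (by finiteness) hbad
  rw [← ENNReal.ofReal_add hδ0.le hδ0.le, ENNReal.toReal_ofReal (by positivity)] at hbad'
  have hGg : (∫⁻ s, (G n s : ℝ≥0∞) ^ α ∂m).toReal ≤ I := by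
    refine ENNReal.toReal_mono hgi.ne (lintegral_mono fun s => ?_)
    exact ENNReal.rpow_le_rpow (by exact_mod_cast hG.le n s) hα.le
  have h1 := mul_le_mul_of_nonneg_right hbad' (Real.rpow_nonneg hr0.le (-α))
  have h2 := mul_le_mul_of_nonneg_right hGg (Real.rpow_nonneg hK.le (-α))
  have h3 : (δ + δ) * r ^ (-α) = η / 3 := by
    rw [hδ, Real.rpow_neg hr0.le]
    have : r ^ α ≠ 0 := by positivity
    field_simp; ring
  linarith

/-- If the integrals of simple functions increasing to `g` converge in probability, then
`g ∈ L^α_+(m)`. -/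
theorem mem_LPlus_of_isIntegralLimit (hf : IsLossFunction f) (hα : 0 < α)
    (hM : IsFrechetSupMeasure f α κ m P M) {g : E → ℝ≥0} (hgm : Measurable g) {Y : Ω → Vec d}
    (hY : IsIntegralLimit f m P M g Y) : g ∈ LPlus α m := by
  obtain ⟨hYm, G, X, hG, hX, hlim⟩ := hY
  refine (mem_LPlus_iff hα).2 ⟨hgm, ?_⟩
  by_contra htop
  rw [not_lt, top_le_iff] at htop
  have hI : Tendsto (fun n => ∫⁻ s, (G n s : ℝ≥0∞) ^ α ∂m) atTop (𝓝 ∞) := by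
    rw [← htop]
    refine lintegral_tendsto_of_tendsto_of_monotone
      (fun n => ((hG.simple n).measurable.coe_nnreal_ennreal.pow_const α).aemeasurable)
      (ae_of_all _ fun s => monotone_nat_of_le_succ fun n => ?_) (ae_of_all _ fun s => ?_)
    · exact ENNReal.rpow_le_rpow (by exact_mod_cast hG.mono n s) hα.le
    · exact ((ENNReal.continuous_rpow_const.tendsto _).comp
        (ENNReal.tendsto_coe.2 (hG.tendsto s)))
  obtain ⟨c, hc0, hc⟩ := hf.exists_le_norm
  obtain ⟨L, hL⟩ : ∃ L : ℕ, P.real {ω | (L : ℝ) < ‖Y ω‖} < 1 / 3 := by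
    have hanti : Antitone fun L : ℕ => {ω | (L : ℝ) < ‖Y ω‖} := by
      intro a b hab ω (hω : (b : ℝ) < ‖Y ω‖)
      exact lt_of_le_of_lt (Nat.cast_le.2 hab) hω
    have hemp : (⋂ L : ℕ, {ω | (L : ℝ) < ‖Y ω‖}) = ∅ := by
      refine Set.eq_empty_of_forall_notMem fun ω hω => ?_
      obtain ⟨L, hL⟩ := exists_nat_ge ‖Y ω‖
      exact not_lt.2 hL (Set.mem_iInter.1 hω L)
    have htend := tendsto_measure_iInter_atTop (μ := P)
      (fun L : ℕ => (measurableSet_lt (measurable_const (a := (L : ℝ)))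
        hYm.norm).nullMeasurableSet) hanti ⟨0, measure_ne_top _ _⟩
    rw [hemp, measure_empty] at htend
    obtain ⟨L, hL⟩ := (htend.eventually_lt_const
      (u := ENNReal.ofReal (1 / 3)) (by simp)).exists
    exact ⟨L, (ENNReal.lt_ofReal_iff_toReal_lt (measure_ne_top _ _)).1 hL⟩
  -- If `‖Y‖ ≤ L` and `‖X n - Y‖ < 1`, then `f (X n) ≤ c * (L + 1)`. The extra `1` keeps the level
  -- positive if `c = 0`. Thus three events of probability below `1 / 3` would cover `Ω`.
  have hZ : Tendsto (fun n => P.real {ω | f (X n ω) ≤ c * (L + 1) + 1}) atTop (𝓝 0) := by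
    set t : ℝ := c * (L + 1) + 1 with ht
    have ht0 : 0 < t := by positivity
    refine squeeze_zero (fun n => measureReal_nonneg)
      (fun n => (real_loss_le hf hα hM (hX n) ht0).2) ?_
    refine Real.tendsto_exp_neg_atTop_nhds_zero.comp ?_
    refine Tendsto.atTop_mul_const (by positivity) ?_
    refine tendsto_atTop.2 fun b => ?_
    filter_upwards [hI.eventually_const_lt (u := ENNReal.ofReal b) (by simp)] with n hn
    exact (ENNReal.ofReal_le_iff_le_toReal (real_loss_le hf hα hM (hX n) ht0).1.ne).1 hn.le
  have hXY := tendstoInMeasure_iff_measureReal_norm.1 hlim 1 one_pos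
  obtain ⟨n, hn1, hn2⟩ := ((hZ.eventually_lt_const (u := 1 / 3) (by norm_num)).and
    (hXY.eventually_lt_const (u := 1 / 3) (by norm_num))).exists
  have hcov : (Set.univ : Set Ω) ⊆ ({ω | f (X n ω) ≤ c * (L + 1) + 1} ∪
      {ω | 1 ≤ ‖X n ω - Y ω‖}) ∪ {ω | (L : ℝ) < ‖Y ω‖} := by
    intro ω _
    by_contra hcon
    simp only [Set.mem_union, Set.mem_ofPred_eq, not_or, not_le, not_lt] at hcon
    obtain ⟨⟨h1, h2⟩, h3⟩ := hcon
    have h4 : ‖X n ω‖ ≤ L + 1 := by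
      have := norm_add_le (X n ω - Y ω) (Y ω)
      rw [sub_add_cancel] at this
      linarith
    have h5 := (hc (X n ω)).trans (mul_le_mul_of_nonneg_left h4 hc0)
    linarith
  have h1 := measureReal_mono (μ := P) hcov
  rw [probReal_univ] at h1
  have h2 := measureReal_union_le (μ := P) ({ω | f (X n ω) ≤ c * (L + 1) + 1} ∪
      {ω | 1 ≤ ‖X n ω - Y ω‖}) {ω | (L : ℝ) < ‖Y ω‖}
  have h3 := measureReal_union_le (μ := P) {ω | f (X n ω) ≤ c * (L + 1) + 1}
    {ω | 1 ≤ ‖X n ω - Y ω‖}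
  linarith

end Integral

end ImplicitExtremal

/-! ### The main theorem -/

theorem mainTheorem1 {d : ℕ} (f : Vec d → ℝ) (hf : IsLossFunction f)
    (α : ℝ) (hα : 0 < α) (κ : Measure (UnitLevel f)) [IsProbabilityMeasure κ]
    {E : Type*} [MeasurableSpace E] (m : Measure E) [SigmaFinite m]
    {Ω : Type*} [MeasurableSpace Ω] (P : Measure Ω) [IsProbabilityMeasure P]
    (M : Set E → Ω → Vec d) (hM : IsFrechetSupMeasure f α κ m P M) :
    -- (a)
    integrableFunctions f m P M = LPlus α m ∧
    -- (b)
    ∀ g ∈ LPlus α m,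
      -- convergence in probability along every sequence of simple functions `G n ↑ g`
      (∀ (G : ℕ → E → ℝ≥0) (X : ℕ → Ω → Vec d), SimpleUp m G g →
        (∀ n, IsSimpleIntegral f m P M (G n) (X n)) →
        ∃ Y : Ω → Vec d, Measurable Y ∧ TendstoInMeasure P X atTop Y) ∧
      -- the limit does a.s. not depend on the sequence
      (∀ Y Y' : Ω → Vec d, IsIntegralLimit f m P M g Y → IsIntegralLimit f m P M g Y' →
        Y =ᵐ[P] Y') ∧
      -- so `I(g)` is well defined: it is such a limit, and the limit along every sequence
      IsIntegralLimit f m P M g (extremalIntegral f m P M g) ∧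
      (∀ (G : ℕ → E → ℝ≥0) (X : ℕ → Ω → Vec d), SimpleUp m G g →
        (∀ n, IsSimpleIntegral f m P M (G n) (X n)) →
        TendstoInMeasure P X atTop (extremalIntegral f m P M g)) := by
  have hconv : ∀ g ∈ LPlus α m, ∀ (G : ℕ → E → ℝ≥0) (X : ℕ → Ω → Vec d), SimpleUp m G g →
      (∀ n, IsSimpleIntegral f m P M (G n) (X n)) →
      ∃ Y : Ω → Vec d, Measurable Y ∧ TendstoInMeasure P X atTop Y :=
    fun g hg G X hG hX =>
      (jointlyCauchyInMeasure_integral hf hα hM hg hG hG hX hX).exists_limit fun n => (hX n).1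
  have hex : ∀ g ∈ LPlus α m, ∃ Y, IsIntegralLimit f m P M g Y := by
    intro g hg
    obtain ⟨G, hG⟩ := exists_simpleUp (m := m) hg.1
    choose X hX using fun n => exists_isSimpleIntegral hf hM.isImplicitSupMeasure (hG.simple n)
    obtain ⟨Y, hY, hlim⟩ := hconv g hg G X hG hX
    exact ⟨Y, hY, G, X, hG, hX, hlim⟩
  refine ⟨Set.Subset.antisymm ?_ fun g hg => ⟨hg.1, hex g hg⟩, fun g hg => ?_⟩
  · rintro g ⟨hgm, Y, hY⟩
    exact mem_LPlus_of_isIntegralLimit hf hα hM hgm hY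
  have hI : IsIntegralLimit f m P M g (extremalIntegral f m P M g) := by
    rw [extremalIntegral, dif_pos (hex g hg)]
    exact (hex g hg).choose_spec
  have hall : ∀ Y, IsIntegralLimit f m P M g Y → ∀ (G : ℕ → E → ℝ≥0) (X : ℕ → Ω → Vec d),
      SimpleUp m G g → (∀ n, IsSimpleIntegral f m P M (G n) (X n)) →
      TendstoInMeasure P X atTop Y := by
    rintro Y ⟨-, G, X, hG, hX, hlim⟩ G' X' hG' hX'
    exact (jointlyCauchyInMeasure_integral hf hα hM hg hG hG' hX hX').tendstoInMeasure hlim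
  refine ⟨hconv g hg, ?_, hI, hall _ hI⟩
  rintro Y Y' hY ⟨-, G, X, hG, hX, hlim⟩
  exact tendstoInMeasure_ae_unique (hall Y hY G X hG hX) hlim
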